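/- Let $a>0$, $q_{\mathrm{FP}}\in(0,1)$ and $\epsilon_{\mathrm{HWa}}>0$, and set $$b:=\min\Big\{\tfrac18,\tfrac a4,\tfrac{q_{\mathrm{FP}}}4\Big\},\qquad \epsilon_{\mathcal B}:=\min\Big\{\frac{\epsilon_{\mathrm{HWa}}}{2b},\frac1{2b},1\Big\}.$$ For $0<\epsilon<\epsilon_{\mathcal B}$ let $c_\epsilon:=(1+\epsilon^2/24)^{1/2}$, $q_\epsilon:=b\epsilon$ and $\delta_\epsilon:=b\epsilon/2$. For $q\in\mathbb R$ and $r\in\{0,1,2,\dots\}$ let $W_q^{r,\infty}$ be the space of all $f\in L^1_{\mathrm{loc}}(\mathbb R,\mathbb C)$ with $e^{-q\cdot}f\in W^{r,\infty}(\mathbb R,\mathbb C)$, with the norm $\|f\|_{W_q^{r,\infty}}:=\|e^{-q\cdot}f\|_{W^{r,\infty}}=\sum_{j=0}^r\|\partial_x^j(e^{-q\cdot}f)\|_{L^\infty}$, and let $L_q^\infty:=W_q^{0,\infty}$. Let $(S^df)(x):=f(x+d)$ and $$\mathcal B_cf:=c^2f''+2f+S^1f+S^{-1}f,\qquad \widetilde{\mathcal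 B}_c(z):=-c^2z^2+2+2\cos z .$$ For $g\in L_q^\infty$ let $\mathfrak L_+[g](z):=\int_0^\infty g(s)e^{-sz}\,ds$ for $\operatorname{Re}z>q$ and $\mathfrak L_-[g](z):=\int_0^\infty g(-s)e^{sz}\,ds$ for $\operatorname{Re}z<q$. Then for every $0<\epsilon<\epsilon_{\mathcal B}$ and for both $q=-q_\epsilon$ and $q=q_\epsilon$, the operator $\mathcal B_{c_\epsilon}$ is a bounded linear bijection from $W_q^{2,\infty}$ onto $L_q^\infty$ with bounded inverse. Write $[\mathcal B_{c_\epsilon}^{-}]^{-1}$ for the inverse when $q=-q_\epsilon$ and $[\mathcal B_{c_\epsilon}^{+}]^{-1}$ for the inverse when $q=q_\epsilon$. For $g\in L^\infty_{\pm q_\epsilon}$ and almost every $x\in\mathbb R$, $$\big([\mathcal B_{c_\epsilon}^{\pm}]^{-1}g\big)(x)=\frac1{2\pi i}\int_{\pm q_\epsilon+\delta_\epsilon-i\infty}^{\pm q_\epsilon+\delta_\epsilon+i\infty}\frac{e^{xz}}{\widetilde{\mathcal B}_{c_\epsilon}(iz)}\,\mathfrak L_+[g](z)\,dz+\frac1{2\pi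 i}\int_{\pm q_\epsilon-\delta_\epsilon-i\infty}^{\pm q_\epsilon-\delta_\epsilon+i\infty}\frac{e^{xz}}{\widetilde{\mathcal B}_{c_\epsilon}(iz)}\,\mathfrak L_-[g](z)\,dz ,$$ where both integrals converge absolutely for every $x\in\mathbb R$. Moreover, there is a constant $C>0$, depending only on $a$, $q_{\mathrm{FP}}$ and $\epsilon_{\mathrm{HWa}}$, such that for all $0<\epsilon<\epsilon_{\mathcal B}$ $$\big\|[\mathcal B_{c_\epsilon}^{\pm}]^{-1}\big\|_{L_{\pm q_\epsilon}^\infty\to W_{\pm q_\epsilon}^{2,\infty}}\le C\epsilon^{-1}.$$ -/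

import Mathlib

open MeasureTheory
open scoped ENNReal ContDiff

noncomputable section

namespace AdvanceDelay

/-! ### Weak derivatives -/

/-- `v` is the `k`-th weak (distributional) derivative of `u` on the real line. -/
def IsWeakDeriv (k : ℕ) (u v : ℝ → ℂ) : Prop :=
  LocallyIntegrable u ∧ LocallyIntegrable v ∧
    ∀ φ : ℝ → ℝ, ContDiff ℝ ∞ φ → HasCompactSupport φ →
      ∫ x, iteratedDeriv k φ x • u x = (-1) ^ k * ∫ x, φ x • v x

theorem IsWeakDeriv.congr {k : ℕ} {u v u' v' : ℝ → ℂ} (h : IsWeakDeriv k u v)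
    (hu : u =ᵐ[volume] u') (hv : v =ᵐ[volume] v') : IsWeakDeriv k u' v' := by
  refine ⟨h.1.congr hu, h.2.1.congr hv, fun φ hφ hs => ?_⟩
  have e1 : ∫ x, iteratedDeriv k φ x • u' x = ∫ x, iteratedDeriv k φ x • u x :=
    integral_congr_ae (hu.mono fun x hx => by simp only [hx])
  have e2 : ∫ x, φ x • v' x = ∫ x, φ x • v x :=
    integral_congr_ae (hv.mono fun x hx => by simp only [hx])
  rw [e1, e2, h.2.2 φ hφ hs]

theorem hasCompactSupport_iteratedDeriv {φ : ℝ → ℝ} (hs : HasCompactSupport φ) (k : ℕ) :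
    HasCompactSupport (iteratedDeriv k φ) := by
  induction k with
  | zero => simpa using hs
  | succ k ih => rw [iteratedDeriv_succ]; exact ih.deriv

theorem integrable_iteratedDeriv_smul {φ : ℝ → ℝ} (hφ : ContDiff ℝ ∞ φ)
    (hs : HasCompactSupport φ) (k : ℕ) {u : ℝ → ℂ} (hu : LocallyIntegrable u) :
    Integrable fun x => iteratedDeriv k φ x • u x :=
  hu.integrable_smul_left_of_hasCompactSupport
    (hφ.continuous_iteratedDeriv k (mod_cast le_top)) (hasCompactSupport_iteratedDeriv hs k)

theorem integrable_test_smul {φ : ℝ → ℝ} (hφ : ContDiff ℝ ∞ φ)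
    (hs : HasCompactSupport φ) {u : ℝ → ℂ} (hu : LocallyIntegrable u) :
    Integrable fun x => φ x • u x :=
  hu.integrable_smul_left_of_hasCompactSupport hφ.continuous hs

theorem IsWeakDeriv.add {k : ℕ} {u v u' v' : ℝ → ℂ} (h : IsWeakDeriv k u v)
    (h' : IsWeakDeriv k u' v') : IsWeakDeriv k (u + u') (v + v') := by
  refine ⟨h.1.add h'.1, h.2.1.add h'.2.1, fun φ hφ hs => ?_⟩
  simp only [Pi.add_apply, smul_add]
  rw [integral_add (integrable_iteratedDeriv_smul hφ hs k h.1)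
      (integrable_iteratedDeriv_smul hφ hs k h'.1),
    integral_add (integrable_test_smul hφ hs h.2.1) (integrable_test_smul hφ hs h'.2.1),
    h.2.2 φ hφ hs, h'.2.2 φ hφ hs, mul_add]

theorem IsWeakDeriv.const_smul {k : ℕ} {u v : ℝ → ℂ} (h : IsWeakDeriv k u v) (a : ℂ) :
    IsWeakDeriv k (a • u) (a • v) := by
  refine ⟨h.1.smul a, h.2.1.smul a, fun φ hφ hs => ?_⟩
  simp only [Pi.smul_apply, smul_comm _ a]
  rw [integral_smul, integral_smul, h.2.2 φ hφ hs, smul_eq_mul, smul_eq_mul]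
  ring

theorem isWeakDeriv_zero (k : ℕ) : IsWeakDeriv k (0 : ℝ → ℂ) 0 :=
  ⟨locallyIntegrable_zero, locallyIntegrable_zero, fun φ _ _ => by simp⟩

theorem IsWeakDeriv.unique {k : ℕ} {u v w : ℝ → ℂ} (h : IsWeakDeriv k u v)
    (h' : IsWeakDeriv k u w) : v =ᵐ[volume] w := by
  refine ae_eq_of_integral_contDiff_smul_eq h.2.1 h'.2.1 fun φ hφ hs => ?_
  have := (h.2.2 φ hφ hs).symm.trans (h'.2.2 φ hφ hs)
  exact mul_left_cancel₀ (pow_ne_zero _ (by norm_num)) this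

/-! ### One-sided exponentially weighted spaces -/

/-- The function `e^{-q x} f(x)`. -/
def weighted (q : ℝ) (f : ℝ → ℂ) : ℝ → ℂ :=
  fun x => Complex.exp (-(q * x : ℝ)) * f x

/-- The space `W_q^{r,∞}` of (almost everywhere classes of) locally integrable functions
`f : ℝ → ℂ` such that `e^{-q x} f(x)` lies in `W^{r,∞}`: all of its weak derivatives of order
at most `r` exist and are essentially bounded. -/
def WInf (q : ℝ) (r : ℕ) : Submodule ℂ (ℝ →ₘ[volume] ℂ) where
  carrier := {f | LocallyIntegrable f ∧
    ∀ j : Fin (r + 1), ∃ v : Lp ℂ ∞ (volume : Measure ℝ), IsWeakDeriv j (weighted q f) v}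
  zero_mem' := by
    have h0 : ((0 : ℝ →ₘ[volume] ℂ) : ℝ → ℂ) =ᵐ[volume] 0 := AEEqFun.coeFn_zero
    refine ⟨LocallyIntegrable.congr locallyIntegrable_zero h0.symm, fun j => ⟨0, ?_⟩⟩
    refine (isWeakDeriv_zero j).congr ?_ (Lp.coeFn_zero ℂ ∞ volume).symm
    filter_upwards [h0] with x hx
    simp [weighted, hx]
  add_mem' := by
    intro f g hf hg
    have h0 := AEEqFun.coeFn_add f g
    refine ⟨(hf.1.add hg.1).congr h0.symm, fun j => ?_⟩
    obtain ⟨v, hv⟩ := hf.2 j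
    obtain ⟨w, hw⟩ := hg.2 j
    refine ⟨v + w, (hv.add hw).congr ?_ (Lp.coeFn_add v w).symm⟩
    filter_upwards [h0] with x hx
    simp [weighted, hx, mul_add]
  smul_mem' := by
    intro a f hf
    have h0 := AEEqFun.coeFn_smul a f
    refine ⟨(hf.1.smul a).congr h0.symm, fun j => ?_⟩
    obtain ⟨v, hv⟩ := hf.2 j
    refine ⟨a • v, (hv.const_smul a).congr ?_ (Lp.coeFn_smul a v).symm⟩
    filter_upwards [h0] with x hx
    simp only [weighted, hx, Pi.smul_apply, smul_eq_mul]
    ring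

/-- The space `L_q^∞ = W_q^{0,∞}`. -/
abbrev LInf (q : ℝ) : Submodule ℂ (ℝ →ₘ[volume] ℂ) := WInf q 0

variable {q : ℝ} {r : ℕ}

/-- The `j`-th weak derivative of `e^{-q x} f(x)`, as an element of `L^∞`. -/
def wderiv (f : WInf q r) (j : Fin (r + 1)) : Lp ℂ ∞ (volume : Measure ℝ) :=
  (f.2.2 j).choose

theorem wderiv_spec (f : WInf q r) (j : Fin (r + 1)) :
    IsWeakDeriv j (weighted q (f : ℝ →ₘ[volume] ℂ)) (wderiv f j) :=
  (f.2.2 j).choose_spec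

theorem wderiv_eq (f : WInf q r) (j : Fin (r + 1)) {v : Lp ℂ ∞ (volume : Measure ℝ)}
    (hv : IsWeakDeriv j (weighted q (f : ℝ →ₘ[volume] ℂ)) v) : wderiv f j = v :=
  Lp.ext ((wderiv_spec f j).unique hv)

theorem wderiv_add (f g : WInf q r) (j : Fin (r + 1)) :
    wderiv (f + g) j = wderiv f j + wderiv g j := by
  refine wderiv_eq _ _ (((wderiv_spec f j).add (wderiv_spec g j)).congr ?_
    (Lp.coeFn_add _ _).symm)
  filter_upwards [AEEqFun.coeFn_add (f : ℝ →ₘ[volume] ℂ) g] with x hx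
  simp [weighted, hx, mul_add]

theorem wderiv_smul (a : ℂ) (f : WInf q r) (j : Fin (r + 1)) :
    wderiv (a • f) j = a • wderiv f j := by
  refine wderiv_eq _ _ (((wderiv_spec f j).const_smul a).congr ?_ (Lp.coeFn_smul _ _).symm)
  filter_upwards [AEEqFun.coeFn_smul a (f : ℝ →ₘ[volume] ℂ)] with x hx
  simp only [weighted, Submodule.coe_smul, hx, Pi.smul_apply, smul_eq_mul]
  ring

theorem eq_zero_of_wderiv_zero (f : WInf q r) (h : wderiv f 0 = 0) : f = 0 := by
  have h1 := wderiv_spec f 0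
  have h2 : IsWeakDeriv 0 (weighted q (f : ℝ →ₘ[volume] ℂ)) (weighted q f) :=
    ⟨h1.1, h1.1, fun φ _ _ => by simp⟩
  have h3 := h2.unique h1
  rw [h] at h3
  apply Subtype.ext
  apply AEEqFun.ext
  filter_upwards [h3, Lp.coeFn_zero ℂ ∞ (volume : Measure ℝ),
    AEEqFun.coeFn_zero (α := ℝ) (β := ℂ) (μ := volume)] with x h3 h4 h5
  rw [h4] at h3
  simp only [weighted, Pi.zero_apply, mul_eq_zero, Complex.exp_ne_zero, false_or] at h3
  simp only [Submodule.coe_zero, h5, Pi.zero_apply, h3]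

/-- `‖f‖_{W_q^{r,∞}} = ‖e^{-q·} f‖_{W^{r,∞}}`, the sum of the `L^∞` norms of the weak
derivatives of order at most `r` of `e^{-q x} f(x)`. -/
instance : NormedAddCommGroup (WInf q r) :=
  AddGroupNorm.toNormedAddCommGroup
    { toFun := fun f => ∑ j, ‖wderiv f j‖
      map_zero' := by
        refine Finset.sum_eq_zero fun j _ => ?_
        have := wderiv_smul (0 : ℂ) (0 : WInf q r) j
        rw [zero_smul, zero_smul] at this
        rw [this, norm_zero]
      add_le' := fun f g => by
        rw [← Finset.sum_add_distrib]
        refine Finset.sum_le_sum fun j _ => ?_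
        rw [wderiv_add]
        exact norm_add_le _ _
      neg' := fun f => by
        refine Finset.sum_congr rfl fun j _ => ?_
        have := wderiv_smul (-1 : ℂ) f j
        rw [neg_one_smul ℂ f, neg_one_smul ℂ (wderiv f j)] at this
        rw [this, norm_neg]
      eq_zero_of_map_eq_zero' := fun f h => by
        have := (Finset.sum_eq_zero_iff_of_nonneg fun j _ => norm_nonneg (wderiv f j)).1 h 0
          (Finset.mem_univ _)
        exact eq_zero_of_wderiv_zero f (norm_eq_zero.1 this) }

theorem norm_def (f : WInf q r) : ‖f‖ = ∑ j, ‖wderiv f j‖ := rfl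

instance : NormedSpace ℂ (WInf q r) where
  norm_smul_le a f := by
    rw [norm_def, norm_def, Finset.mul_sum]
    refine Finset.sum_le_sum fun j _ => ?_
    rw [wderiv_smul, norm_smul]

/-! ### The operator `B_c` -/

/-- The shift `(S^d f)(x) = f(x + d)`. -/
def shift (d : ℝ) (f : ℝ →ₘ[volume] ℂ) : ℝ →ₘ[volume] ℂ :=
  f.compMeasurePreserving (fun x => x + d) (measurePreserving_add_right volume d)

/-- `f` has a weak second derivative and `B_c f = c² f'' + 2 f + S¹ f + S⁻¹ f` equals `g`. -/
def IsBImage (c : ℝ) (f g : ℝ →ₘ[volume] ℂ) : Prop :=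
  ∃ f₂ : ℝ →ₘ[volume] ℂ, IsWeakDeriv 2 f f₂ ∧
    g = ((c : ℂ) ^ 2) • f₂ + (2 : ℂ) • f + shift 1 f + shift (-1) f

/-- The symbol of `B_c`. -/
def symbolB (c : ℝ) (z : ℂ) : ℂ := -(c : ℂ) ^ 2 * z ^ 2 + 2 + 2 * Complex.cos z

/-! ### Laplace transforms and contour integrals -/

/-- `∫_0^∞ f(s) e^{-sz} ds`. -/
def laplacePlus (f : ℝ → ℂ) (z : ℂ) : ℂ :=
  ∫ s in Set.Ioi (0 : ℝ), f s * Complex.exp (-(s * z))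

/-- `∫_0^∞ f(-s) e^{sz} ds`. -/
def laplaceMinus (f : ℝ → ℂ) (z : ℂ) : ℂ :=
  ∫ s in Set.Ioi (0 : ℝ), f (-s) * Complex.exp (s * z)

/-- The point `σ + it` of the vertical line `Re z = σ`. -/
def vline (σ t : ℝ) : ℂ := σ + t * Complex.I

/-- `(1 / 2πi) ∫_{σ - i∞}^{σ + i∞} F(z) dz`, with `z = σ + it`, `dz = i dt`. -/
def contourIntegral (σ : ℝ) (F : ℂ → ℂ) : ℂ :=
  1 / (2 * Real.pi * Complex.I) * ∫ t : ℝ, F (vline σ t) * Complex.I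

/-- The kernel `e^{xz} / B̃_c(iz)`. -/
def kernelK (c x : ℝ) (z : ℂ) : ℂ := Complex.exp (x * z) / symbolB c (Complex.I * z)

/-! ### Parameters -/

/-- The wave speed `c_ε`. -/
def waveSpeed (ε : ℝ) : ℝ := Real.sqrt (1 + ε ^ 2 / 24)

/-- The constant `b = min {1/8, a/4, q_FP/4}`. -/
def rateB (a qFP : ℝ) : ℝ := min (1 / 8) (min (a / 4) (qFP / 4))

/-- The threshold `ε_B = min {ε_HWa/(2b), 1/(2b), 1}`. -/
def epsB (a qFP εHWa : ℝ) : ℝ :=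
  min (εHWa / (2 * rateB a qFP)) (min (1 / (2 * rateB a qFP)) 1)

end AdvanceDelay

end

open AdvanceDelay

noncomputable section

namespace AdvanceDelay

/-! ### The characteristic function and its factorization -/

/-! On exponentials, `B_c` acts by `e^{zx} ↦ p(z) e^{zx}` with `p = charFun c`. The inverse should
therefore be convolution with the Green's function `G` obtained by integrating `e^{yz}/p(z)` along
`Re z = q`. All bounds are uniform for `1 ≤ c` and `c² ≤ 25/24`.

The function `p` is a product of two factors whose moduli at `σ + it` are those of `charFactor c` at
`σ ± it` (`norm_charFun`). Elementary estimates give `|p| ≥ |σ|(1 + t²)/400` for `|σ| ≤ 1/4`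
(`norm_charFun_ge`). Hence `p` has no zeros in this strip off the imaginary axis, and contours move
freely on either side of the axis.

Bounding `G` directly on `Re z = q` costs a factor `1/|q|`, and the convolution costs another,
giving only `ε⁻²`. The rate `ε⁻¹` rests on a bound for `G` by a constant times `e^{qy - |q||y|}`
(`norm_green_le_exp`). On one side of `y = 0` this comes from moving the contour out to `Re z =
±1/4`. On the other side the contour must cross the imaginary axis, and the price is a jump that is
bounded in `y` (`norm_green_sub_le`). The jump is in substance the residues at the imaginary zeros
of `p`, but it is bounded without locating them. On lines `±σ` very close to the axis, the
difference of the integrands is dominated by a Poisson-type kernel in the increasing variable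
`charPhase`, and its integral does not blow up as `σ → 0`.

Convolution with `G` then has norm of order `1/|q|`. It solves the equation weakly, because Fourier
inversion makes `G` a fundamental solution (`adjK_green_opB`). The equation itself yields `f''`, and
Landau's inequality (`IsWeakDeriv.exists_one`) yields `f'`. For uniqueness, the homogeneous equation
is tested against solutions of `B_c ψ = φ`, after a cutoff (`eq_zero_of_integral_opB_eq_zero`). The
contour formula is Fubini: the two Laplace integrals give the parts `s > 0` and `s < 0` of the
convolution. -/

/-- The characteristic function `c² z² + 2 + 2 cosh z` of the operator `B_c`. -/
def charFun (c : ℝ) (z : ℂ) : ℂ := (c : ℂ) ^ 2 * z ^ 2 + 2 + 2 * Complex.cosh z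

/-- The factor `c z - 2 i cosh (z / 2)` of the characteristic function. -/
def charFactor (c : ℝ) (z : ℂ) : ℂ := c * z - 2 * Complex.I * Complex.cosh (z / 2)

/-- The imaginary part of `charFactor c` at `σ + i t`. -/
def charPhase (c σ t : ℝ) : ℝ := c * t - 2 * Real.cosh (σ / 2) * Real.cos (t / 2)

/-- A lower bound for the square of the modulus of `charFactor c` at `σ + i t`. -/
def charQuad (c σ t : ℝ) : ℝ := (σ / 20) ^ 2 + charPhase c σ t ^ 2

theorem symbolB_I_mul (c : ℝ) (z : ℂ) : symbolB c (Complex.I * z) = charFun c z := by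
  have h : Complex.cos (Complex.I * z) = Complex.cosh z := by
    rw [mul_comm, Complex.cos_mul_I]
  rw [symbolB, charFun, h, mul_pow, Complex.I_sq]
  ring

theorem charFun_eq_mul (c : ℝ) (z : ℂ) :
    charFun c z = charFactor c z * (c * z + 2 * Complex.I * Complex.cosh (z / 2)) := by
  have h : Complex.cosh z = 2 * Complex.cosh (z / 2) ^ 2 - 1 := by
    have h1 := Complex.cosh_two_mul (z / 2)
    have h2 := Complex.cosh_sq (z / 2)
    rw [mul_div_cancel₀ z two_ne_zero] at h1
    rw [h1]
    linear_combination -h2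
  rw [charFun, charFactor, h]
  linear_combination (4 * Complex.cosh (z / 2) ^ 2) * Complex.I_sq

theorem vline_re (σ t : ℝ) : (vline σ t).re = σ := by simp [vline]

theorem vline_im (σ t : ℝ) : (vline σ t).im = t := by simp [vline]

theorem conj_vline (σ t : ℝ) : (starRingEnd ℂ) (vline σ t) = vline σ (-t) := by
  apply Complex.ext <;> simp [vline]

/-- Conjugation flips the sign of `i` in the second factor, so that factor at `z` is the conjugate
of `charFactor c` at `conj z`. One function at heights `±t` thus controls `p`. -/
theorem norm_charFun (c σ t : ℝ) : ‖charFun c (vline σ t)‖ =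
    ‖charFactor c (vline σ t)‖ * ‖charFactor c (vline σ (-t))‖ := by
  have h : charFactor c (vline σ (-t)) = (starRingEnd ℂ)
      (c * vline σ t + 2 * Complex.I * Complex.cosh (vline σ t / 2)) := by
    rw [charFactor, ← conj_vline]
    simp only [map_add, map_mul, Complex.conj_ofReal, Complex.conj_I, ← Complex.cosh_conj,
      map_div₀, Complex.conj_ofNat]
    ring
  rw [charFun_eq_mul, norm_mul, h, RCLike.norm_conj]

theorem charFactor_vline (c σ t : ℝ) : charFactor c (vline σ t) =
    ((c * σ + 2 * Real.sinh (σ / 2) * Real.sin (t / 2) : ℝ) : ℂ) +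
      (charPhase c σ t : ℝ) * Complex.I := by
  have h : Complex.cosh (vline σ t / 2) = Complex.cosh ((σ / 2 : ℝ) : ℂ) *
      Complex.cos ((t / 2 : ℝ) : ℂ) +
      Complex.sinh ((σ / 2 : ℝ) : ℂ) * (Complex.sin ((t / 2 : ℝ) : ℂ) * Complex.I) := by
    rw [← Complex.cosh_mul_I, ← Complex.sinh_mul_I, ← Complex.cosh_add]
    congr 1
    simp only [vline]
    push_cast
    ring
  rw [charFactor, h, vline, charPhase]
  push_cast
  linear_combination (-2 * Complex.sinh (σ / 2) * Complex.sin (t / 2)) * Complex.I_sq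

theorem charFactor_re (c σ t : ℝ) : (charFactor c (vline σ t)).re =
    c * σ + 2 * Real.sinh (σ / 2) * Real.sin (t / 2) := by
  rw [charFactor_vline, Complex.add_re, Complex.ofReal_re, Complex.re_ofReal_mul, Complex.I_re,
    mul_zero, add_zero]

theorem charFactor_im (c σ t : ℝ) : (charFactor c (vline σ t)).im = charPhase c σ t := by
  rw [charFactor_vline, Complex.add_im, Complex.ofReal_im, Complex.im_ofReal_mul, Complex.I_im,
    mul_one, zero_add]

/-! ### Elementary estimates -/

theorem cosh_le_of_abs_le {s : ℝ} (hs : |s| ≤ 1 / 8) : Real.cosh s ≤ 101 / 100 := by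
  have h0 : s ^ 2 ≤ 1 / 64 := by
    rw [← sq_abs]; nlinarith [abs_nonneg s]
  have h1 := Real.cosh_le_exp_half_sq s
  have h2 : Real.exp (s ^ 2 / 2) ≤ Real.exp (1 / 128) := Real.exp_le_exp.2 (by linarith)
  have h3 : (1 - 1 / 128 : ℝ) ≤ Real.exp (-(1 / 128)) := by
    have := Real.add_one_le_exp (-(1 / 128 : ℝ)); linarith
  have h4 : Real.exp (1 / 128) * Real.exp (-(1 / 128)) = 1 := by
    rw [← Real.exp_add]; simp
  nlinarith [Real.exp_pos (1 / 128 : ℝ)]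

theorem abs_sinh_le_of_abs_le {s : ℝ} (hs : |s| ≤ 1 / 8) :
    |Real.sinh s| ≤ 101 / 100 * |s| := by
  have := (convex_Icc (-(1 / 8) : ℝ) (1 / 8)).norm_image_sub_le_of_norm_hasDerivWithin_le
    (f := Real.sinh) (f' := Real.cosh) (C := 101 / 100) (x := 0) (y := s)
    (fun x _ => (Real.hasDerivAt_sinh x).hasDerivWithinAt)
    (fun x hx => by
      rw [Real.norm_eq_abs, abs_of_pos (Real.cosh_pos x)]
      exact cosh_le_of_abs_le (abs_le.2 hx)) (by norm_num) (abs_le.1 hs)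
  simpa using this

/-- The threshold `11/5` separates two regimes. Below it `|sin (t/2)|` stays away from `1`; above it
`|t|` exceeds `2 cosh (σ/2)`, which is at most `2.02`. -/
theorem cos_half_ge {t : ℝ} (ht : |t| ≤ 11 / 5) : 79 / 200 ≤ Real.cos (t / 2) := by
  have h0 : t ^ 2 ≤ 121 / 25 := by
    rw [← sq_abs]; nlinarith [abs_nonneg t]
  have := Real.one_sub_sq_div_two_le_cos (x := t / 2)
  nlinarith

theorem abs_sin_half_le {t : ℝ} (ht : |t| ≤ 11 / 5) : |Real.sin (t / 2)| ≤ 23 / 25 := by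
  have h1 := cos_half_ge ht
  have h2 := Real.sin_sq_add_cos_sq (t / 2)
  refine abs_le_of_sq_le_sq (by nlinarith) (by norm_num)

variable {c σ t : ℝ}

/-- The term `cσ` dominates `2 sinh (σ/2) sin (t/2)`, which is at most `1.01 · 0.92 · |σ|` in
modulus. -/
theorem charFactor_re_ge (hc : 1 ≤ c) (hσ : |σ| ≤ 1 / 4) (ht : |t| ≤ 11 / 5) :
    |σ| / 20 ≤ |(charFactor c (vline σ t)).re| := by
  have hs : |σ / 2| ≤ 1 / 8 := by rw [abs_div, abs_two]; linarith
  have h1 := abs_sinh_le_of_abs_le hs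
  rw [abs_div, abs_two] at h1
  have h2 := abs_sin_half_le ht
  rw [charFactor_re]
  have h3 : |2 * Real.sinh (σ / 2) * Real.sin (t / 2)| ≤
      2 * (101 / 100 * (|σ| / 2)) * (23 / 25) := by
    rw [abs_mul, abs_mul, abs_two]
    gcongr
  have h4 : |c * σ| ≤ |c * σ + 2 * Real.sinh (σ / 2) * Real.sin (t / 2)| +
      |2 * Real.sinh (σ / 2) * Real.sin (t / 2)| := by
    have := abs_sub (c * σ + 2 * Real.sinh (σ / 2) * Real.sin (t / 2))
      (2 * Real.sinh (σ / 2) * Real.sin (t / 2))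
    rwa [add_sub_cancel_right] at this
  have h5 : |σ| ≤ |c * σ| := by
    rw [abs_mul, abs_of_pos (by linarith : 0 < c)]
    nlinarith [abs_nonneg σ]
  linarith [abs_nonneg σ]

theorem charQuad_le (hc : 1 ≤ c) (hσ : |σ| ≤ 1 / 4) (ht : |t| ≤ 11 / 5) :
    charQuad c σ t ≤ ‖charFactor c (vline σ t)‖ ^ 2 := by
  have h := charFactor_re_ge hc hσ ht
  rw [← Complex.normSq_eq_norm_sq, Complex.normSq_apply, charFactor_im, charQuad]
  have : (σ / 20) ^ 2 ≤ (charFactor c (vline σ t)).re ^ 2 := by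
    apply sq_le_sq.2
    rwa [abs_div, abs_of_pos (by norm_num : (0 : ℝ) < 20)]
  nlinarith

theorem norm_charFactor_ge_of_large (hc : 1 ≤ c) (hσ : |σ| ≤ 1 / 4) (ht : 11 / 5 ≤ |t|) :
    |t| / 20 ≤ ‖charFactor c (vline σ t)‖ := by
  have hs : |σ / 2| ≤ 1 / 8 := by rw [abs_div, abs_two]; linarith
  refine le_trans ?_ (Complex.abs_im_le_norm _)
  rw [charFactor_im, charPhase]
  have h1 : |2 * Real.cosh (σ / 2) * Real.cos (t / 2)| ≤ 2 * (101 / 100) * 1 := by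
    rw [abs_mul, abs_mul, abs_two, abs_of_pos (Real.cosh_pos _)]
    gcongr
    · exact cosh_le_of_abs_le hs
    · exact Real.abs_cos_le_one _
  have h2 := abs_sub_abs_le_abs_sub (c * t) (2 * Real.cosh (σ / 2) * Real.cos (t / 2))
  have h3 : |t| ≤ |c * t| := by
    rw [abs_mul, abs_of_pos (by linarith : 0 < c)]
    nlinarith [abs_nonneg t]
  linarith

/-- At height `-|t|` both terms of the phase are nonpositive and cannot cancel. Only the factor at
height `|t|` can make `p` small. -/
theorem norm_charFactor_neg_abs_ge (hc : 1 ≤ c) (ht : |t| ≤ 11 / 5) :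
    79 / 100 ≤ ‖charFactor c (vline σ (-|t|))‖ := by
  refine le_trans ?_ (Complex.abs_im_le_norm _)
  rw [charFactor_im, charPhase]
  have h1 := cos_half_ge (t := -|t|) (by rwa [abs_neg, abs_abs])
  have h2 := Real.one_le_cosh (σ / 2)
  have h3 : 79 / 200 ≤ Real.cosh (σ / 2) * Real.cos (-|t| / 2) := by nlinarith
  have h4 : 0 ≤ c * |t| := by positivity
  rw [abs_of_nonpos (by nlinarith)]
  nlinarith

theorem norm_charFun_abs (c σ t : ℝ) : ‖charFun c (vline σ t)‖ =
    ‖charFactor c (vline σ |t|)‖ * ‖charFactor c (vline σ (-|t|))‖ := by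
  rcases abs_cases t with ⟨h, _⟩ | ⟨h, _⟩ <;> rw [norm_charFun, h]
  rw [neg_neg, mul_comm]

theorem charQuad_nonneg (c σ t : ℝ) : 0 ≤ charQuad c σ t := by
  unfold charQuad; positivity

theorem charQuad_half_le_norm_charFun_sq (hc : 1 ≤ c) (hσ : |σ| ≤ 1 / 4) (ht : |t| ≤ 11 / 5) :
    charQuad c σ |t| / 2 ≤ ‖charFun c (vline σ t)‖ ^ 2 := by
  have h1 := charQuad_le hc hσ (t := |t|) (by rwa [abs_abs])
  have h2 := norm_charFactor_neg_abs_ge (σ := σ) hc ht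
  have h3 : 1 / 2 ≤ ‖charFactor c (vline σ (-|t|))‖ ^ 2 := by nlinarith
  rw [norm_charFun_abs, mul_pow]
  nlinarith [charQuad_nonneg c σ |t|]

theorem norm_charFun_ge_of_large (hc : 1 ≤ c) (hσ : |σ| ≤ 1 / 4) (ht : 11 / 5 ≤ |t|) :
    (1 + t ^ 2) / 500 ≤ ‖charFun c (vline σ t)‖ := by
  have h1 := norm_charFactor_ge_of_large hc hσ ht
  have h2 := norm_charFactor_ge_of_large (t := -t) hc hσ (by rwa [abs_neg])
  rw [abs_neg] at h2
  have h3 : |t| / 20 * (|t| / 20) ≤ ‖charFun c (vline σ t)‖ := by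
    rw [norm_charFun]
    gcongr
  have h4 : |t| * |t| = t ^ 2 := by rw [← sq, sq_abs]
  nlinarith

/-- The bound degenerates linearly at the imaginary axis, which is why the jump across it needs the
finer quantity `charQuad`. -/
theorem norm_charFun_ge (hc : 1 ≤ c) (hσ : |σ| ≤ 1 / 4) :
    |σ| * (1 + t ^ 2) / 400 ≤ ‖charFun c (vline σ t)‖ := by
  rcases le_total |t| (11 / 5) with ht | ht
  · have h1 := (charFactor_re_ge hc hσ (t := |t|) (by rwa [abs_abs])).trans
      (Complex.abs_re_le_norm _)
    have h2 := norm_charFactor_neg_abs_ge (σ := σ) hc ht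
    have h3 : |σ| / 20 * (79 / 100) ≤ ‖charFun c (vline σ t)‖ := by
      rw [norm_charFun_abs]
      gcongr
    have h4 : t ^ 2 ≤ 121 / 25 := by
      rw [← sq_abs]; nlinarith [abs_nonneg t]
    nlinarith [abs_nonneg σ]
  · have h1 := norm_charFun_ge_of_large hc hσ ht
    nlinarith [abs_nonneg σ, sq_nonneg t]

theorem charFun_ne_zero (hc : 1 ≤ c) (hσ : |σ| ≤ 1 / 4) (h0 : σ ≠ 0) :
    charFun c (vline σ t) ≠ 0 := by
  have h := norm_charFun_ge (t := t) hc hσ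
  have : 0 < |σ| * (1 + t ^ 2) / 400 := by positivity
  exact norm_pos_iff.1 (this.trans_le h)

theorem hasDerivAt_charPhase (c σ t : ℝ) :
    HasDerivAt (charPhase c σ) (c + Real.cosh (σ / 2) * Real.sin (t / 2)) t := by
  have h1 : HasDerivAt (fun t : ℝ => t / 2) (1 / 2) t := (hasDerivAt_id t).div_const 2
  have h2 := (h1.cos).const_mul (2 * Real.cosh (σ / 2))
  have h3 := ((hasDerivAt_id t).const_mul c).sub h2
  refine h3.congr_deriv ?_
  ring

/-- Monotonicity with a uniform rate allows the phase to serve as integration variable near its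
zero. -/
theorem deriv_charPhase_ge (hc : 1 ≤ c) (hσ : |σ| ≤ 1 / 4) (ht : |t| ≤ 11 / 5) :
    1 / 20 ≤ c + Real.cosh (σ / 2) * Real.sin (t / 2) := by
  have hs : |σ / 2| ≤ 1 / 8 := by rw [abs_div, abs_two]; linarith
  have h1 : |Real.cosh (σ / 2) * Real.sin (t / 2)| ≤ 101 / 100 * (23 / 25) := by
    rw [abs_mul, abs_of_pos (Real.cosh_pos _)]
    gcongr
    · exact cosh_le_of_abs_le hs
    · exact abs_sin_half_le ht
  have := (abs_le.1 h1).1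
  linarith

/-- The part of `p` even in `σ` cancels; what remains is purely imaginary and odd in `σ`. -/
theorem norm_charFun_sub_le (hc : 1 ≤ c) (hc' : c ^ 2 ≤ 25 / 24) (hσ : |σ| ≤ 1 / 4)
    (ht : |t| ≤ 11 / 5) :
    ‖charFun c (vline σ t) - charFun c (vline (-σ) t)‖ ≤ 20 * |σ| := by
  have hs : |Real.sinh σ| ≤ 2 * |σ| := by
    have h2 : |σ / 2| ≤ 1 / 8 := by rw [abs_div, abs_two]; linarith
    have h3 := abs_sinh_le_of_abs_le h2
    have h4 := cosh_le_of_abs_le h2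
    have h5 := Real.sinh_two_mul (σ / 2)
    rw [mul_div_cancel₀ σ two_ne_zero] at h5
    rw [h5, abs_mul, abs_mul, abs_two, abs_of_pos (Real.cosh_pos _)]
    rw [abs_div, abs_two] at h3
    calc 2 * |Real.sinh (σ / 2)| * Real.cosh (σ / 2)
        ≤ 2 * (101 / 100 * (|σ| / 2)) * (101 / 100) := by gcongr
      _ ≤ 2 * |σ| := by nlinarith [abs_nonneg σ]
  have e : charFun c (vline σ t) - charFun c (vline (-σ) t) =
      ((4 * c ^ 2 * σ * t + 4 * Real.sinh σ * Real.sin t : ℝ) : ℂ) * Complex.I := by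
    simp only [charFun, vline, Complex.cosh_add, Complex.ofReal_neg, Complex.cosh_neg,
      Complex.sinh_neg, Complex.sinh_mul_I, Complex.cosh_mul_I]
    push_cast
    ring
  rw [e, norm_mul, Complex.norm_I, mul_one, Complex.norm_real, Real.norm_eq_abs]
  calc |4 * c ^ 2 * σ * t + 4 * Real.sinh σ * Real.sin t|
      ≤ |4 * c ^ 2 * σ * t| + |4 * Real.sinh σ * Real.sin t| := abs_add_le _ _
    _ = 4 * c ^ 2 * |σ| * |t| + 4 * |Real.sinh σ| * |Real.sin t| := by
        simp only [abs_mul, abs_pow, abs_of_pos (by linarith : 0 < c),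
          abs_of_pos (by norm_num : (0 : ℝ) < 4)]
    _ ≤ 4 * (25 / 24) * |σ| * (11 / 5) + 4 * (2 * |σ|) * 1 := by
        gcongr
        exact Real.abs_sin_le_one t
    _ ≤ 20 * |σ| := by nlinarith [abs_nonneg σ]

end AdvanceDelay
end

noncomputable section

namespace AdvanceDelay

open Filter Topology

/-! ### Shifting vertical contours -/

theorem integrable_const_div_one_add_sq (M : ℝ) : Integrable fun t : ℝ => M / (1 + t ^ 2) := by
  simpa only [div_eq_mul_inv] using integrable_inv_one_add_sq.const_mul M

theorem integral_const_div_one_add_sq (M : ℝ) : ∫ t : ℝ, M / (1 + t ^ 2) = M * Real.pi := by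
  simp only [div_eq_mul_inv]
  rw [integral_const_mul, integral_univ_inv_one_add_sq]

theorem continuous_vline (σ : ℝ) : Continuous (vline σ) := by
  unfold vline; fun_prop

/-- Cauchy's theorem on rectangles of height `2T`: the horizontal sides are `O(T⁻²)` and vanish in
the limit. -/
theorem integral_vline_eq {F : ℂ → ℂ} {σ₁ σ₂ M : ℝ} (h : σ₁ ≤ σ₂)
    (hd : ∀ σ ∈ Set.Icc σ₁ σ₂, ∀ t, DifferentiableAt ℂ F (vline σ t))
    (hM : ∀ σ ∈ Set.Icc σ₁ σ₂, ∀ t, ‖F (vline σ t)‖ ≤ M / (1 + t ^ 2)) :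
    ∫ t, F (vline σ₁ t) = ∫ t, F (vline σ₂ t) := by
  have hint : ∀ σ ∈ Set.Icc σ₁ σ₂, Integrable fun t => F (vline σ t) := fun σ hσ => by
    have hc : Continuous fun t => F (vline σ t) :=
      continuous_iff_continuousAt.2 fun t =>
        (hd σ hσ t).continuousAt.comp (continuous_vline σ).continuousAt
    exact (integrable_const_div_one_add_sq M).mono' hc.aestronglyMeasurable
      (Eventually.of_forall (hM σ hσ))
  have hlim : ∀ σ ∈ Set.Icc σ₁ σ₂, Tendsto (fun T : ℝ => ∫ t in (-T)..T, F (vline σ t)) atTop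
      (𝓝 (∫ t, F (vline σ t))) := fun σ hσ =>
    intervalIntegral_tendsto_integral (hint σ hσ) tendsto_neg_atTop_atBot tendsto_id
  -- The values `s = 1` and `s = -1` give the top and bottom sides.
  have hhor : ∀ s : ℝ, s ^ 2 = 1 → Tendsto (fun T : ℝ => ∫ x in σ₁..σ₂, F (vline x (s * T))) atTop
      (𝓝 0) := fun s hs => by
    have h1 : Tendsto (fun T : ℝ => M / (1 + T ^ 2) * |σ₂ - σ₁|) atTop (𝓝 0) := by
      have h2 : Tendsto (fun T : ℝ => 1 + T ^ 2) atTop atTop :=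
        tendsto_atTop_add_const_left _ _ (tendsto_pow_atTop two_ne_zero)
      simpa using (h2.const_div_atTop M).mul_const |σ₂ - σ₁|
    refine squeeze_zero_norm (fun T => ?_) h1
    refine intervalIntegral.norm_integral_le_of_norm_le_const fun x hx => ?_
    rw [Set.uIoc_of_le h] at hx
    have := hM x ⟨hx.1.le, hx.2⟩ (s * T)
    rwa [mul_pow, hs, one_mul] at this
  have hrect : ∀ T : ℝ, (∫ x in σ₁..σ₂, F (vline x ((-1) * T))) -
      (∫ x in σ₁..σ₂, F (vline x (1 * T))) + Complex.I • (∫ t in (-T)..T, F (vline σ₂ t)) -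
      Complex.I • (∫ t in (-T)..T, F (vline σ₁ t)) = 0 := fun T => by
    have := Complex.integral_boundary_rect_eq_zero_of_differentiableOn F (vline σ₁ (-T))
      (vline σ₂ T) (fun z hz => by
        rw [Complex.mem_reProdIm, vline_re, vline_re, Set.uIcc_of_le h] at hz
        have e : z = vline z.re z.im := by apply Complex.ext <;> simp [vline]
        rw [e]
        exact (hd _ hz.1 _).differentiableWithinAt)
    rw [vline_re, vline_re, vline_im, vline_im] at this
    simpa only [vline, neg_mul, one_mul] using this
  have hI := hlim σ₁ (Set.left_mem_Icc.2 h)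
  have hJ := hlim σ₂ (Set.right_mem_Icc.2 h)
  have := (((hhor (-1) (by norm_num)).sub (hhor 1 (by norm_num))).add
    (hJ.const_smul Complex.I)).sub (hI.const_smul Complex.I)
  simp only [hrect] at this
  have h0 := tendsto_nhds_unique this tendsto_const_nhds
  rw [sub_zero, zero_add, ← smul_sub, smul_eq_zero] at h0
  exact (sub_eq_zero.1 (h0.resolve_left Complex.I_ne_zero)).symm

/-! ### The Green's function -/

/-- The Green's function of `B_c` obtained from the contour `Re z = σ`. -/
def green (c σ y : ℝ) : ℂ := contourIntegral σ (kernelK c y)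

theorem kernelK_eq (c y : ℝ) (z : ℂ) : kernelK c y z = Complex.exp (y * z) / charFun c z := by
  rw [kernelK, symbolB_I_mul]

theorem norm_exp_mul_vline (y σ t : ℝ) : ‖Complex.exp (y * vline σ t)‖ = Real.exp (y * σ) := by
  rw [Complex.norm_exp, Complex.re_ofReal_mul, vline_re]

theorem norm_kernelK (c y σ t : ℝ) :
    ‖kernelK c y (vline σ t)‖ = Real.exp (y * σ) / ‖charFun c (vline σ t)‖ := by
  rw [kernelK_eq, norm_div, norm_exp_mul_vline]

theorem norm_contourIntegral_le {σ : ℝ} {F : ℂ → ℂ} {b : ℝ → ℝ} (hb : Integrable b)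
    (h : ∀ t, ‖F (vline σ t)‖ ≤ b t) :
    ‖contourIntegral σ F‖ ≤ (2 * Real.pi)⁻¹ * ∫ t, b t := by
  have h1 : ‖∫ t : ℝ, F (vline σ t) * Complex.I‖ ≤ ∫ t, b t :=
    norm_integral_le_of_norm_le hb (Eventually.of_forall fun t => by
      rw [norm_mul, Complex.norm_I, mul_one]; exact h t)
  have h2 : ‖(1 / (2 * Real.pi * Complex.I) : ℂ)‖ = (2 * Real.pi)⁻¹ := by
    simp [abs_of_pos Real.pi_pos]
  rw [contourIntegral, norm_mul, h2]
  gcongr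

variable {c σ : ℝ}

theorem continuous_charFun (c : ℝ) : Continuous (charFun c) := by
  unfold charFun; fun_prop

theorem norm_kernelK_le (hc : 1 ≤ c) (hσ : |σ| ≤ 1 / 4) (h0 : σ ≠ 0) (y t : ℝ) :
    ‖kernelK c y (vline σ t)‖ ≤ (400 / |σ| * Real.exp (y * σ)) / (1 + t ^ 2) := by
  have h1 := norm_charFun_ge (t := t) hc hσ
  have h2 : 0 < |σ| := abs_pos.2 h0
  have h3 : 0 < |σ| * (1 + t ^ 2) / 400 := by positivity
  rw [norm_kernelK]
  calc Real.exp (y * σ) / ‖charFun c (vline σ t)‖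
      ≤ Real.exp (y * σ) / (|σ| * (1 + t ^ 2) / 400) := by gcongr
    _ = _ := by field_simp

theorem continuous_kernelK_vline (hc : 1 ≤ c) (hσ : |σ| ≤ 1 / 4) (h0 : σ ≠ 0) :
    Continuous fun x : ℝ × ℝ => kernelK c x.1 (vline σ x.2) := by
  simp only [kernelK_eq]
  refine Continuous.div ?_ ?_ fun x => charFun_ne_zero hc hσ h0
  · exact Complex.continuous_exp.comp
      ((Complex.continuous_ofReal.comp continuous_fst).mul
        ((continuous_vline σ).comp continuous_snd))
  · exact (continuous_charFun c).comp ((continuous_vline σ).comp continuous_snd)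

theorem integrable_kernelK (hc : 1 ≤ c) (hσ : |σ| ≤ 1 / 4) (h0 : σ ≠ 0) (y : ℝ) :
    Integrable fun t => kernelK c y (vline σ t) :=
  (integrable_const_div_one_add_sq _).mono'
    ((continuous_kernelK_vline hc hσ h0).comp (Continuous.prodMk_right y)).aestronglyMeasurable
    (Eventually.of_forall (norm_kernelK_le hc hσ h0 y))

/-- This crude bound is meant for `σ = ±1/4`; its constant blows up at the axis. -/
theorem norm_green_le (hc : 1 ≤ c) (hσ : |σ| ≤ 1 / 4) (h0 : σ ≠ 0) (y : ℝ) :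
    ‖green c σ y‖ ≤ 200 / |σ| * Real.exp (y * σ) := by
  have := norm_contourIntegral_le (integrable_const_div_one_add_sq _)
    (norm_kernelK_le hc hσ h0 y)
  rw [integral_const_div_one_add_sq] at this
  refine this.trans_eq ?_
  field_simp
  norm_num

theorem green_eq_of_le {σ₁ σ₂ m : ℝ} (hc : 1 ≤ c) (h : σ₁ ≤ σ₂) (hm : 0 < m)
    (hs : ∀ σ ∈ Set.Icc σ₁ σ₂, m ≤ |σ| ∧ |σ| ≤ 1 / 4) (y : ℝ) :
    green c σ₁ y = green c σ₂ y := by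
  have key := integral_vline_eq (F := kernelK c y) (M := 400 / m * Real.exp (|y| * (1 / 4))) h
    (fun σ hσ t => by
      have h0 : σ ≠ 0 := abs_pos.1 (hm.trans_le (hs σ hσ).1)
      rw [show kernelK c y = fun z => Complex.exp (y * z) / charFun c z from
        funext (kernelK_eq c y)]
      refine DifferentiableAt.div (by fun_prop) ?_ (charFun_ne_zero hc (hs σ hσ).2 h0)
      unfold charFun
      fun_prop)
    (fun σ hσ t => by
      have h0 : σ ≠ 0 := abs_pos.1 (hm.trans_le (hs σ hσ).1)
      refine (norm_kernelK_le hc (hs σ hσ).2 h0 y t).trans ?_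
      have h1 : y * σ ≤ |y| * (1 / 4) := (le_abs_self _).trans (by
        rw [abs_mul]
        exact mul_le_mul_of_nonneg_left (hs σ hσ).2 (abs_nonneg y))
      have := (hs σ hσ).1
      gcongr)
  rw [green, green, contourIntegral, contourIntegral, integral_mul_const, integral_mul_const, key]

theorem green_eq_of_pos {σ₁ σ₂ : ℝ} (hc : 1 ≤ c) (h0 : 0 < σ₁) (h1 : σ₁ ≤ σ₂) (h2 : σ₂ ≤ 1 / 4)
    (y : ℝ) : green c σ₁ y = green c σ₂ y :=
  green_eq_of_le hc h1 h0 (fun σ hσ => by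
    rw [abs_of_pos (h0.trans_le hσ.1)]
    exact ⟨hσ.1, hσ.2.trans h2⟩) y

theorem green_eq_of_neg {σ₁ σ₂ : ℝ} (hc : 1 ≤ c) (h0 : σ₂ < 0) (h1 : σ₁ ≤ σ₂) (h2 : -(1 / 4) ≤ σ₁)
    (y : ℝ) : green c σ₁ y = green c σ₂ y :=
  green_eq_of_le hc h1 (neg_pos.2 h0) (fun σ hσ => by
    rw [abs_of_neg (hσ.2.trans_lt h0)]
    exact ⟨neg_le_neg hσ.2, by linarith [hσ.1]⟩) y

/-! ### The jump of the Green's function across the imaginary axis -/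

theorem charQuad_pos (h0 : σ ≠ 0) (t : ℝ) : 0 < charQuad c σ t := by
  unfold charQuad
  positivity

theorem continuous_charQuad (c σ : ℝ) : Continuous (charQuad c σ) := by
  unfold charQuad charPhase; fun_prop

theorem continuous_div_charQuad (h0 : σ ≠ 0) : Continuous fun t => σ / charQuad c σ t :=
  continuous_const.div (continuous_charQuad c σ) fun t => (charQuad_pos h0 t).ne'

/-- Up to the slope of the phase, the integrand is a Poisson kernel of width `σ/20` in the phase.
Since that slope is at least `1/20`, the integrand is below the derivative of `400 arctan (20 ·
phase / σ)`, whose total variation is at most `400π` for every `σ`. -/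
theorem integral_div_charQuad_le (hc : 1 ≤ c) (hσ : |σ| ≤ 1 / 4) (h0 : 0 < σ) :
    ∫ t in (-(11 / 5) : ℝ)..(11 / 5), σ / charQuad c σ t ≤ 400 * Real.pi := by
  let A : ℝ → ℝ := fun t => 400 * Real.arctan (20 / σ * charPhase c σ t)
  let A' : ℝ → ℝ := fun t =>
    400 * (1 / (1 + (20 / σ * charPhase c σ t) ^ 2) *
      (20 / σ * (c + Real.cosh (σ / 2) * Real.sin (t / 2))))
  have hA : ∀ t, HasDerivAt A (A' t) t := fun t =>
    (((hasDerivAt_charPhase c σ t).const_mul (20 / σ)).arctan).const_mul 400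
  have hcA : Continuous A' := by
    have hp : Continuous (charPhase c σ) := by unfold charPhase; fun_prop
    refine continuous_const.mul (Continuous.mul (continuous_const.div (by fun_prop) fun t => ?_)
      (by fun_prop))
    positivity
  have hle : ∀ t ∈ Set.Icc (-(11 / 5) : ℝ) (11 / 5), σ / charQuad c σ t ≤ A' t := fun t ht => by
    have h1 := deriv_charPhase_ge hc hσ (abs_le.2 ht)
    have e : A' t = 20 * (c + Real.cosh (σ / 2) * Real.sin (t / 2)) * (σ / charQuad c σ t) := by
      simp only [A', charQuad]
      field_simp
      ring
    rw [e]
    have h2 : 0 < σ / charQuad c σ t := div_pos h0 (charQuad_pos h0.ne' t)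
    nlinarith
  calc ∫ t in (-(11 / 5) : ℝ)..(11 / 5), σ / charQuad c σ t
      ≤ ∫ t in (-(11 / 5) : ℝ)..(11 / 5), A' t :=
        intervalIntegral.integral_mono_on (by norm_num)
          ((continuous_div_charQuad h0.ne').intervalIntegrable _ _) (hcA.intervalIntegrable _ _) hle
    _ = A (11 / 5) - A (-(11 / 5)) :=
        intervalIntegral.integral_eq_sub_of_hasDerivAt (fun t _ => hA t)
          (hcA.intervalIntegrable _ _)
    _ ≤ 400 * Real.pi := by
        simp only [A]
        have h1 := Real.arctan_lt_pi_div_two (20 / σ * charPhase c σ (11 / 5))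
        have h2 := Real.neg_pi_div_two_lt_arctan (20 / σ * charPhase c σ (-(11 / 5)))
        linarith

theorem charQuad_neg_left (c σ t : ℝ) : charQuad c (-σ) t = charQuad c σ t := by
  simp [charQuad, charPhase, neg_div]

/-- The difference of quotients splits into a change of denominator, `O(σ)/(p p')`, and a change of
exponential, `O(|y|σ)/p'`. Both are controlled by `σ/Q`, up to a bounded remainder, because `|p|²`
and `|p'|²` are at least `Q/2`. -/
theorem norm_kernelK_sub_le_of_small (hc : 1 ≤ c) (hc' : c ^ 2 ≤ 25 / 24) (h0 : 0 < σ) {y t : ℝ}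
    (hσ : |σ| ≤ 1 / 4) (hy : |y| * σ ≤ 1 / 8) (hy' : y ^ 2 * σ ≤ 1 / 4) (ht : |t| ≤ 11 / 5) :
    ‖kernelK c y (vline σ t) - kernelK c y (vline (-σ) t)‖ ≤
      83 * (σ / charQuad c σ |t|) + 6 / (1 + t ^ 2) := by
  set Q := charQuad c σ |t| with hQ
  have hQ0 : 0 < Q := charQuad_pos h0.ne' _
  have hσn : |-σ| ≤ 1 / 4 := by rwa [abs_neg]
  have h1 := charQuad_half_le_norm_charFun_sq hc hσ ht
  have h2 := charQuad_half_le_norm_charFun_sq hc hσn ht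
  rw [charQuad_neg_left, ← hQ] at h2
  rw [← hQ] at h1
  have h3 := norm_charFun_sub_le hc hc' hσ ht
  rw [abs_of_pos h0] at h3
  have hp := charFun_ne_zero (t := t) hc hσ h0.ne'
  have hp' := charFun_ne_zero (t := t) hc hσn (neg_ne_zero.2 h0.ne')
  rw [kernelK_eq, kernelK_eq]
  set p := charFun c (vline σ t)
  set p' := charFun c (vline (-σ) t)
  set A := Complex.exp (y * vline σ t) with hA
  set A' := Complex.exp (y * vline (-σ) t) with hA'
  have hp0 : 0 < ‖p‖ := norm_pos_iff.2 hp
  have hp0' : 0 < ‖p'‖ := norm_pos_iff.2 hp'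
  have hpp : Q / 2 ≤ ‖p‖ * ‖p'‖ := by
    refine le_of_sq_le_sq ?_ (by positivity)
    rw [mul_pow, sq (Q / 2)]
    exact mul_le_mul h1 h2 (by positivity) (by positivity)
  have hyσ : |y * σ| ≤ 1 / 8 := by rwa [abs_mul, abs_of_pos h0]
  have nA : ‖A‖ ≤ 2 := by
    rw [hA, norm_exp_mul_vline]
    have h4 := abs_sinh_le_of_abs_le hyσ
    have h5 := cosh_le_of_abs_le hyσ
    rw [← Real.cosh_add_sinh]
    have := le_abs_self (Real.sinh (y * σ))
    linarith
  have nAA : ‖A - A'‖ ≤ 3 * |y| * σ := by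
    have e : A - A' = Complex.exp (y * t * Complex.I) * ((2 * Real.sinh (y * σ) : ℝ) : ℂ) := by
      rw [hA, hA', vline, vline, mul_add, mul_add, Complex.exp_add, Complex.exp_add,
        Real.sinh_eq]
      push_cast
      rw [← mul_assoc (y : ℂ)]
      ring_nf
    have e2 : ‖Complex.exp (y * t * Complex.I)‖ = 1 := by
      rw [← Complex.ofReal_mul, Complex.norm_exp_ofReal_mul_I]
    rw [e, norm_mul, e2, one_mul, Complex.norm_real, Real.norm_eq_abs, abs_mul, abs_two]
    have h4 := abs_sinh_le_of_abs_le hyσ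
    rw [abs_mul, abs_of_pos h0] at h4
    nlinarith [mul_nonneg (abs_nonneg y) h0.le]
  have e : A / p - A' / p' = A * (p' - p) / (p * p') + (A - A') / p' := by
    field_simp
    ring
  have b1 : ‖A * (p' - p) / (p * p')‖ ≤ 80 * (σ / Q) := by
    rw [norm_div, norm_mul, norm_mul, norm_sub_rev]
    calc ‖A‖ * ‖p - p'‖ / (‖p‖ * ‖p'‖) ≤ 2 * (20 * σ) / (Q / 2) := by gcongr
      _ = 80 * (σ / Q) := by field_simp; norm_num
  have b2 : ‖(A - A') / p'‖ ≤ 3 * (σ / Q) + 1 := by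
    rw [norm_div]
    have h4 : σ / ‖p'‖ ^ 2 ≤ σ / (Q / 2) := by gcongr
    have h5 : σ / (Q / 2) = 2 * (σ / Q) := by field_simp
    -- By the inequality `2uv ≤ u² + v²` with `u = 1/‖p'‖` and `v = |y|`; the assumption on `y² σ`
    -- absorbs the second square.
    have h6 : 3 * |y| * σ / ‖p'‖ ≤ 3 / 2 * (σ / ‖p'‖ ^ 2 + y ^ 2 * σ) := by
      have h7 : 0 ≤ σ * (1 / ‖p'‖ - |y|) ^ 2 := by positivity
      have e3 : σ / ‖p'‖ ^ 2 = σ * (1 / ‖p'‖) ^ 2 := by field_simp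
      have e4 : 3 * |y| * σ / ‖p'‖ = 3 * |y| * σ * (1 / ‖p'‖) := by field_simp
      rw [e3, e4, ← sq_abs y]
      nlinarith
    calc ‖A - A'‖ / ‖p'‖ ≤ 3 * |y| * σ / ‖p'‖ := by gcongr
      _ ≤ 3 * (σ / Q) + 1 := by linarith
  have b3 : 1 ≤ 6 / (1 + t ^ 2) := by
    rw [le_div_iff₀ (by positivity), ← sq_abs]
    nlinarith [abs_nonneg t]
  rw [e]
  refine (norm_add_le _ _).trans ?_
  linarith

theorem norm_kernelK_le_of_large (hc : 1 ≤ c) (hσ : |σ| ≤ 1 / 4) {y t : ℝ}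
    (hy : |y * σ| ≤ 1 / 8) (ht : 11 / 5 ≤ |t|) :
    ‖kernelK c y (vline σ t)‖ ≤ 1000 / (1 + t ^ 2) := by
  have h1 := norm_charFun_ge_of_large hc hσ ht
  have h2 : Real.exp (y * σ) ≤ 2 := by
    have h4 := abs_sinh_le_of_abs_le hy
    have h5 := cosh_le_of_abs_le hy
    rw [← Real.cosh_add_sinh]
    have := le_abs_self (Real.sinh (y * σ))
    linarith
  rw [norm_kernelK]
  calc Real.exp (y * σ) / ‖charFun c (vline σ t)‖ ≤ 2 / ((1 + t ^ 2) / 500) := by gcongr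
    _ = 1000 / (1 + t ^ 2) := by field_simp; norm_num

theorem norm_green_sub_le_of_small (hc : 1 ≤ c) (hc' : c ^ 2 ≤ 25 / 24) (h0 : 0 < σ) {y : ℝ}
    (hσ : |σ| ≤ 1 / 4) (hy : |y| * σ ≤ 1 / 8) (hy' : y ^ 2 * σ ≤ 1 / 4) :
    ‖green c σ y - green c (-σ) y‖ ≤ 40000 := by
  have hσn : |-σ| ≤ 1 / 4 := by rwa [abs_neg]
  have hyσ : |y * σ| ≤ 1 / 8 := by rwa [abs_mul, abs_of_pos h0]
  have hyσn : |y * -σ| ≤ 1 / 8 := by rwa [mul_neg, abs_neg]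
  set S : Set ℝ := Set.Ioc (-(11 / 5)) (11 / 5) with hS
  set r : ℝ → ℝ := fun t => σ / charQuad c σ t with hr
  have hr0 : ∀ t, 0 ≤ r t := fun t => div_nonneg h0.le (charQuad_nonneg c σ t)
  have hrc : Continuous r := continuous_div_charQuad h0.ne'
  -- The sum `r t + r (-t)` dominates the value at `|t|`. The tail constant covers `1000` for each
  -- of the two kernels when `|t| ≥ 11/5`, as well as the remainder `6` for small `t`.
  set b : ℝ → ℝ := fun t => S.indicator (fun t => 83 * (r t + r (-t))) t + 2000 / (1 + t ^ 2)
    with hb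
  have hI1 : Integrable (S.indicator fun t => 83 * (r t + r (-t))) := by
    rw [integrable_indicator_iff measurableSet_Ioc]
    exact (by fun_prop : Continuous fun t => 83 * (r t + r (-t))).integrableOn_Ioc
  have hbi : Integrable b := hI1.add (integrable_const_div_one_add_sq 2000)
  have hint : ∫ t, b t ≤ 83 * (800 * Real.pi) + 2000 * Real.pi := by
    rw [hb, integral_add hI1 (integrable_const_div_one_add_sq 2000),
      integral_const_div_one_add_sq, integral_indicator measurableSet_Ioc,
      ← intervalIntegral.integral_of_le (by norm_num), intervalIntegral.integral_const_mul,
      intervalIntegral.integral_add (hrc.intervalIntegrable _ _)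
        (Continuous.intervalIntegrable (by fun_prop : Continuous fun t => r (-t)) _ _),
      intervalIntegral.integral_comp_neg, neg_neg]
    have := integral_div_charQuad_le hc hσ h0
    linarith
  have hpt : ∀ t, ‖kernelK c y (vline σ t) - kernelK c y (vline (-σ) t)‖ ≤ b t := fun t => by
    by_cases ht : t ∈ S
    · have ht' : |t| ≤ 11 / 5 := abs_le.2 ⟨ht.1.le, ht.2⟩
      have h1 := norm_kernelK_sub_le_of_small hc hc' h0 hσ hy hy' ht'
      have h2 : σ / charQuad c σ |t| ≤ r t + r (-t) := by
        rcases abs_cases t with ⟨h, _⟩ | ⟨h, _⟩ <;> rw [h]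
        · linarith [hr0 (-t), show σ / charQuad c σ t = r t from rfl]
        · linarith [hr0 t, show σ / charQuad c σ (-t) = r (-t) from rfl]
      have h3 : 6 / (1 + t ^ 2) ≤ 2000 / (1 + t ^ 2) := by gcongr; norm_num
      simp only [hb, Set.indicator_of_mem ht]
      linarith
    · have ht' : 11 / 5 ≤ |t| := by
        by_contra! h
        exact ht ⟨(abs_lt.1 h).1, (abs_lt.1 h).2.le⟩
      have h1 := norm_kernelK_le_of_large hc hσ hyσ ht'
      have h2 := norm_kernelK_le_of_large hc hσn hyσn ht'
      have h3 : 2000 / (1 + t ^ 2) = 1000 / (1 + t ^ 2) + 1000 / (1 + t ^ 2) := by ring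
      simp only [hb, Set.indicator_of_notMem ht, zero_add]
      linarith [norm_sub_le (kernelK c y (vline σ t)) (kernelK c y (vline (-σ) t))]
  have e : green c σ y - green c (-σ) y = 1 / (2 * Real.pi * Complex.I) *
      ∫ t : ℝ, (kernelK c y (vline σ t) - kernelK c y (vline (-σ) t)) * Complex.I := by
    rw [green, green, contourIntegral, contourIntegral, ← mul_sub, ← integral_sub]
    · simp only [sub_mul]
    · exact (integrable_kernelK hc hσ h0.ne' y).mul_const _
    · exact (integrable_kernelK hc hσn (neg_ne_zero.2 h0.ne') y).mul_const _
  have h1 : ‖∫ t : ℝ, (kernelK c y (vline σ t) - kernelK c y (vline (-σ) t)) * Complex.I‖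
      ≤ ∫ t, b t :=
    norm_integral_le_of_norm_le hbi (Eventually.of_forall fun t => by
      rw [norm_mul, Complex.norm_I, mul_one]; exact hpt t)
  have h2 : ‖(1 / (2 * Real.pi * Complex.I) : ℂ)‖ = (2 * Real.pi)⁻¹ := by
    simp [abs_of_pos Real.pi_pos]
  rw [e, norm_mul, h2]
  calc (2 * Real.pi)⁻¹ * _ ≤ (2 * Real.pi)⁻¹ * (83 * (800 * Real.pi) + 2000 * Real.pi) := by
        have := Real.pi_pos
        gcongr
        exact h1.trans hint
    _ = 34200 := by field_simp; norm_num
    _ ≤ 40000 := by norm_num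

/-- Both contours are pulled towards the axis, to a distance `s` depending on `y`. The choice `s =
1/(4(1 + y²))` makes `|y| s ≤ 1/8` and `y² s ≤ 1/4`, so the bound near the axis applies for every
`y`. -/
theorem norm_green_sub_le (hc : 1 ≤ c) (hc' : c ^ 2 ≤ 25 / 24) (y : ℝ) :
    ‖green c (1 / 4) y - green c (-(1 / 4)) y‖ ≤ 40000 := by
  set s : ℝ := 1 / (4 * (1 + y ^ 2)) with hs
  have hs0 : 0 < s := by positivity
  have hs1 : s * (4 * (1 + y ^ 2)) = 1 := by rw [hs]; field_simp
  have hs4 : s ≤ 1 / 4 := by nlinarith [mul_nonneg hs0.le (sq_nonneg y)]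
  rw [← green_eq_of_pos hc hs0 hs4 le_rfl, green_eq_of_neg hc (neg_neg_of_pos hs0)
    (neg_le_neg hs4) le_rfl]
  refine norm_green_sub_le_of_small hc hc' hs0 (by rwa [abs_of_pos hs0]) ?_ ?_
  · have : s * (1 - |y|) ^ 2 ≥ 0 := by positivity
    nlinarith [sq_abs y]
  · nlinarith

/-- The weighted Green's function decays exponentially, with a uniform prefactor. -/
theorem norm_green_le_exp (hc : 1 ≤ c) (hc' : c ^ 2 ≤ 25 / 24) {q : ℝ} (hq : |q| ≤ 1 / 8)
    (hq0 : q ≠ 0) (y : ℝ) :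
    ‖green c q y‖ ≤ 41000 * Real.exp (q * y - |q| * |y|) := by
  have hJ := norm_green_sub_le hc hc' y
  have hp := norm_green_le (σ := 1 / 4) hc (by norm_num [abs_of_pos]) (by norm_num) y
  have hn := norm_green_le (σ := -(1 / 4)) hc (by norm_num [abs_of_pos]) (by norm_num) y
  rw [abs_neg] at hn
  norm_num [abs_of_pos] at hp hn
  norm_num at hJ
  have hexp : ∀ u v : ℝ, u ≤ v → 800 * Real.exp u ≤ 41000 * Real.exp v := fun u v h => by
    have := Real.exp_le_exp.2 h
    nlinarith [Real.exp_pos u]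
  -- For `y` of sign opposite to `q` (here `q < 0 ≤ y` or `y ≤ 0 < q`), the target exponent is
  -- `2qy`, weaker than `-|y|/4` since `|q| ≤ 1/8`. Otherwise the target exponent is `0`, and the
  -- opposite line plus the jump give at most `800 + 40000`.
  rcases lt_or_gt_of_ne hq0 with h | h
  · rw [abs_of_neg h] at hq ⊢
    rw [← green_eq_of_neg hc h (by linarith : -(1 / 4) ≤ q) le_rfl]
    norm_num
    rcases le_total 0 y with hy | hy
    · rw [abs_of_nonneg hy]
      exact hn.trans (hexp _ _ (by nlinarith))
    · rw [abs_of_nonpos hy, show q * y + q * -y = 0 by ring, Real.exp_zero]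
      have h1 := hexp (y * (1 / 4)) 0 (by linarith)
      have h2 : Real.exp (y * (1 / 4)) ≤ 1 := Real.exp_le_one_iff.2 (by linarith)
      have h3 := norm_sub_le (green c (1 / 4) y) (green c (1 / 4) y - green c (-(1 / 4)) y)
      rw [sub_sub_cancel] at h3
      linarith
  · rw [abs_of_pos h] at hq ⊢
    rw [green_eq_of_pos hc h (by linarith : q ≤ 1 / 4) le_rfl]
    norm_num
    rcases le_total 0 y with hy | hy
    · rw [abs_of_nonneg hy, sub_self, Real.exp_zero]
      have h2 : Real.exp (y * (-(1 / 4))) ≤ 1 := Real.exp_le_one_iff.2 (by linarith)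
      have h3 := norm_add_le (green c (1 / 4) y - green c (-(1 / 4)) y) (green c (-(1 / 4)) y)
      rw [sub_add_cancel] at h3
      rw [mul_neg] at h2
      linarith
    · rw [abs_of_nonpos hy]
      exact hp.trans (hexp _ _ (by nlinarith))

/-- Pulling out `e^{yσ}` leaves an integrand whose modulus is independent of `y`, so dominated
convergence gives continuity. -/
theorem green_eq_exp_mul (c σ y : ℝ) : green c σ y =
    1 / (2 * Real.pi * Complex.I) * (Complex.exp (y * σ) *
      ∫ t : ℝ, Complex.exp (y * t * Complex.I) / charFun c (vline σ t) * Complex.I) := by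
  rw [green, contourIntegral, ← integral_const_mul (Complex.exp (y * σ))]
  congr 1
  refine integral_congr_ae (Eventually.of_forall fun t => ?_)
  dsimp only
  rw [kernelK_eq, vline, mul_add, Complex.exp_add, ← mul_assoc (y : ℂ)]
  ring

theorem continuous_green (hc : 1 ≤ c) (hσ : |σ| ≤ 1 / 4) (h0 : σ ≠ 0) :
    Continuous (green c σ) := by
  rw [show green c σ = _ from funext (green_eq_exp_mul c σ)]
  have hcont : Continuous fun y : ℝ =>
      ∫ t : ℝ, Complex.exp (y * t * Complex.I) / charFun c (vline σ t) * Complex.I := by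
    have hk : ∀ t, charFun c (vline σ t) ≠ 0 := fun t => charFun_ne_zero hc hσ h0
    have hv : Continuous fun t => charFun c (vline σ t) :=
      (continuous_charFun c).comp (continuous_vline σ)
    refine continuous_of_dominated
      (bound := fun t => (400 / |σ| * Real.exp (0 * σ)) / (1 + t ^ 2)) (fun y => ?_)
      (fun y => Eventually.of_forall fun t => ?_) (integrable_const_div_one_add_sq _)
      (Eventually.of_forall fun t => by fun_prop)
    · exact (Continuous.mul (Continuous.div (by fun_prop) hv hk)
        continuous_const).aestronglyMeasurable
    · refine le_trans (le_of_eq ?_) (norm_kernelK_le hc hσ h0 0 t)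
      rw [norm_kernelK, norm_mul, norm_div, Complex.norm_I, ← Complex.ofReal_mul,
        Complex.norm_exp_ofReal_mul_I]
      simp
  fun_prop

end AdvanceDelay
end

noncomputable section

namespace AdvanceDelay

open Filter Topology

/-! ### Weak derivatives: composition and exponential weights -/

theorem IsWeakDeriv.trans {u v w : ℝ → ℂ} (h : IsWeakDeriv 1 u v) (h' : IsWeakDeriv 1 v w) :
    IsWeakDeriv 2 u w := by
  refine ⟨h.1, h'.2.1, fun φ hφ hs => ?_⟩
  have h1 := h.2.2 (deriv φ) ((contDiff_infty_iff_deriv.1 hφ).2) hs.deriv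
  have h2 := h'.2.2 φ hφ hs
  rw [iteratedDeriv_one] at h1 h2
  rw [iteratedDeriv_succ, iteratedDeriv_one, h1, h2]
  ring

theorem IsWeakDeriv.of_two {u v w : ℝ → ℂ} (h : IsWeakDeriv 1 u v) (h' : IsWeakDeriv 2 u w) :
    IsWeakDeriv 1 v w := by
  refine ⟨h.2.1, h'.2.1, fun φ hφ hs => ?_⟩
  have h1 := h.2.2 (deriv φ) ((contDiff_infty_iff_deriv.1 hφ).2) hs.deriv
  have h2 := h'.2.2 φ hφ hs
  rw [iteratedDeriv_one] at h1
  rw [iteratedDeriv_succ, iteratedDeriv_one] at h2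
  rw [iteratedDeriv_one]
  linear_combination h1 - h2

theorem weighted_weighted (q r : ℝ) (u : ℝ → ℂ) :
    weighted q (weighted r u) = weighted (q + r) u := by
  ext x
  simp only [weighted, ← mul_assoc, ← Complex.exp_add]
  congr 2
  push_cast
  ring

theorem weighted_zero (u : ℝ → ℂ) : weighted 0 u = u := by
  ext x; simp [weighted]

theorem weighted_eq_smul (q : ℝ) (u : ℝ → ℂ) (x : ℝ) :
    weighted q u x = Real.exp (-(q * x)) • u x := by
  rw [weighted, Complex.real_smul, Complex.ofReal_exp]
  push_cast
  rfl

theorem norm_weighted (q : ℝ) (u : ℝ → ℂ) (x : ℝ) :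
    ‖weighted q u x‖ = Real.exp (-(q * x)) * ‖u x‖ := by
  rw [weighted_eq_smul, norm_smul, Real.norm_eq_abs, abs_of_pos (Real.exp_pos _)]

theorem locallyIntegrable_weighted {u : ℝ → ℂ} (hu : LocallyIntegrable u) (q : ℝ) :
    LocallyIntegrable (weighted q u) :=
  hu.continuous_mul (g := fun x : ℝ => Complex.exp (-(q * x : ℝ))) (by fun_prop)

theorem contDiff_exp_neg_mul (q : ℝ) : ContDiff ℝ ∞ fun x : ℝ => Real.exp (-(q * x)) := by
  fun_prop

theorem IsWeakDeriv.weighted {u v : ℝ → ℂ} (h : IsWeakDeriv 1 u v) (q : ℝ) :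
    IsWeakDeriv 1 (weighted q u) (weighted q (v + (-q : ℂ) • u)) := by
  refine ⟨locallyIntegrable_weighted h.1 q,
    locallyIntegrable_weighted (h.2.1.add (h.1.smul (-q : ℂ))) q, fun φ hφ hs => ?_⟩
  set e : ℝ → ℝ := fun x => Real.exp (-(q * x)) with he
  have hse : HasCompactSupport (φ * e) := hs.mul_right
  have hφe : ContDiff ℝ ∞ (φ * e) := hφ.mul (contDiff_exp_neg_mul q)
  have hd : ∀ x, deriv (φ * e) x = deriv φ x * e x - q * (φ x * e x) := fun x => by
    have h1 : HasDerivAt e (-q * e x) x := by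
      have := ((hasDerivAt_id x).const_mul q).neg.exp
      refine this.congr_deriv ?_
      simp only [he, id, Pi.neg_apply]
      ring
    have h2 : HasDerivAt φ (deriv φ x) x :=
      ((hφ.differentiable (by simp)) x).hasDerivAt
    rw [(h2.mul h1).deriv]
    ring
  have h1 := h.2.2 (φ * e) hφe hse
  rw [iteratedDeriv_one] at h1 ⊢
  have i1 := integrable_iteratedDeriv_smul hφe hse 1 h.1
  have i2 := integrable_test_smul hφe hse h.1
  have i3 := integrable_test_smul hφe hse h.2.1
  rw [iteratedDeriv_one] at i1
  have e1 : ∫ x, deriv φ x • AdvanceDelay.weighted q u x =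
      (∫ x, deriv (φ * e) x • u x) + (q : ℂ) * ∫ x, (φ * e) x • u x := by
    rw [← integral_const_mul, ← integral_add i1 (i2.const_mul _)]
    refine integral_congr_ae (Eventually.of_forall fun x => ?_)
    simp only [weighted_eq_smul, hd, Complex.real_smul, Pi.mul_apply]
    simp only [he]
    push_cast
    ring
  have e2 : ∫ x, φ x • AdvanceDelay.weighted q (v + (-q : ℂ) • u) x =
      (∫ x, (φ * e) x • v x) + (-q : ℂ) * ∫ x, (φ * e) x • u x := by
    rw [← integral_const_mul, ← integral_add i3 (i2.const_mul _)]
    refine integral_congr_ae (Eventually.of_forall fun x => ?_)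
    simp only [weighted_eq_smul, Complex.real_smul, Pi.mul_apply, Pi.add_apply, Pi.smul_apply,
      smul_eq_mul, he]
    push_cast
    ring
  rw [e1, e2, h1]
  ring

theorem IsWeakDeriv.weighted_two {u v w : ℝ → ℂ} (h : IsWeakDeriv 1 u v)
    (h' : IsWeakDeriv 2 u w) (q : ℝ) :
    IsWeakDeriv 2 (AdvanceDelay.weighted q u)
      (AdvanceDelay.weighted q (w + (-q : ℂ) • v + (-q : ℂ) • (v + (-q : ℂ) • u))) :=
  (h.weighted q).trans (((h.of_two h').add (h.const_smul (-q : ℂ))).weighted q)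

/-! ### Exponentially bounded functions -/

/-- `f` is measurable with `‖f x‖ ≤ M e^{q x}` almost everywhere. -/
def ExpBdd (q M : ℝ) (f : ℝ → ℂ) : Prop :=
  AEStronglyMeasurable f volume ∧ ∀ᵐ x : ℝ, ‖f x‖ ≤ M * Real.exp (q * x)

variable {q M N : ℝ} {f g : ℝ → ℂ}

theorem ExpBdd.congr (h : ExpBdd q M f) (hfg : f =ᵐ[volume] g) : ExpBdd q M g :=
  ⟨h.1.congr hfg, by filter_upwards [h.2, hfg] with x h1 h2; rwa [← h2]⟩

theorem ExpBdd.mono (h : ExpBdd q M f) (hMN : M ≤ N) : ExpBdd q N f :=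
  ⟨h.1, h.2.mono fun x hx => hx.trans (by gcongr)⟩

theorem ExpBdd.add (hf : ExpBdd q M f) (hg : ExpBdd q N g) : ExpBdd q (M + N) (f + g) :=
  ⟨hf.1.add hg.1, by
    filter_upwards [hf.2, hg.2] with x h1 h2
    exact (norm_add_le _ _).trans (by linarith)⟩

theorem ExpBdd.const_smul (hf : ExpBdd q M f) (a : ℂ) : ExpBdd q (‖a‖ * M) (a • f) :=
  ⟨hf.1.const_smul a, by
    filter_upwards [hf.2] with x h1
    rw [Pi.smul_apply, norm_smul, mul_assoc]
    gcongr⟩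

theorem ExpBdd.comp_add_right (hf : ExpBdd q M f) (d : ℝ) :
    ExpBdd q (Real.exp (q * d) * M) fun x => f (x + d) := by
  have hmp := (measurePreserving_add_right (volume : Measure ℝ) d).quasiMeasurePreserving
  refine ⟨hf.1.comp_quasiMeasurePreserving hmp, ?_⟩
  filter_upwards [hmp.ae hf.2] with x hx
  refine hx.trans_eq ?_
  rw [mul_add, Real.exp_add]
  ring

theorem ExpBdd.locallyIntegrable (hf : ExpBdd q M f) : LocallyIntegrable f := by
  have hc : Continuous fun x : ℝ => M * Real.exp (q * x) := by fun_prop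
  refine hc.locallyIntegrable.mono hf.1 ?_
  filter_upwards [hf.2] with x hx
  exact hx.trans (le_abs_self _)

theorem ExpBdd.weighted (hf : ExpBdd q M f) (r : ℝ) :
    ExpBdd (q - r) M (AdvanceDelay.weighted r f) := by
  refine ⟨(Continuous.aestronglyMeasurable (by fun_prop)).mul hf.1, ?_⟩
  filter_upwards [hf.2] with x hx
  rw [norm_weighted]
  calc Real.exp (-(r * x)) * ‖f x‖ ≤ Real.exp (-(r * x)) * (M * Real.exp (q * x)) := by gcongr
    _ = M * Real.exp ((q - r) * x) := by
      rw [mul_left_comm, ← Real.exp_add]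
      ring_nf

theorem shift_coe (d : ℝ) (f : ℝ →ₘ[volume] ℂ) :
    (shift d f : ℝ → ℂ) =ᵐ[volume] fun x => f (x + d) :=
  f.coeFn_compMeasurePreserving _

/-! ### Membership and norms in the weighted spaces -/

theorem Lp_top_ae_norm_le (v : Lp ℂ ∞ (volume : Measure ℝ)) : ∀ᵐ x, ‖v x‖ ≤ ‖v‖ := by
  have h := ae_le_eLpNormEssSup (f := (v : ℝ → ℂ)) (μ := volume)
  filter_upwards [h] with x hx
  rw [Lp.norm_def, eLpNorm_exponent_top]
  have hfin : eLpNormEssSup (v : ℝ → ℂ) volume ≠ ⊤ := by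
    have := Lp.eLpNorm_ne_top v
    rwa [eLpNorm_exponent_top] at this
  have := ENNReal.toReal_mono hfin hx
  rwa [toReal_enorm] at this

theorem Lp_top_norm_le {v : Lp ℂ ∞ (volume : Measure ℝ)} (hM : 0 ≤ M) (h : ∀ᵐ x, ‖v x‖ ≤ M) :
    ‖v‖ ≤ M := by
  rw [Lp.norm_def, eLpNorm_exponent_top]
  exact ENNReal.toReal_le_of_le_ofReal hM (eLpNormEssSup_le_of_ae_bound h)

theorem ExpBdd.exists_Lp (hf : ExpBdd 0 M f) :
    ∃ v : Lp ℂ ∞ (volume : Measure ℝ), (v : ℝ → ℂ) =ᵐ[volume] f := by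
  have h : MemLp f ∞ := memLp_top_of_bound hf.1 M (by simpa using hf.2)
  exact ⟨h.toLp f, h.coeFn_toLp⟩

theorem norm_wderiv_le {r : ℕ} (f : WInf q r) (j : Fin (r + 1)) {v : ℝ → ℂ} (hM : 0 ≤ M)
    (hv : IsWeakDeriv j (weighted q (f : ℝ →ₘ[volume] ℂ)) v) (hb : ExpBdd 0 M v) :
    ‖wderiv f j‖ ≤ M := by
  refine Lp_top_norm_le hM ?_
  filter_upwards [(wderiv_spec f j).unique hv, hb.2] with x h1 h2
  rw [h1]
  simpa using h2

theorem isWeakDeriv_self (hf : LocallyIntegrable f) : IsWeakDeriv 0 f f :=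
  ⟨hf, hf, fun φ _ _ => by simp⟩

theorem wderiv_zero_ae {r : ℕ} (f : WInf q r) :
    (wderiv f 0 : ℝ → ℂ) =ᵐ[volume] weighted q (f : ℝ →ₘ[volume] ℂ) :=
  (wderiv_spec f 0).unique (isWeakDeriv_self (wderiv_spec f 0).1)

theorem expBdd_wderiv {r : ℕ} (f : WInf q r) (j : Fin (r + 1)) :
    ExpBdd 0 ‖wderiv f j‖ (wderiv f j) :=
  ⟨Lp.aestronglyMeasurable _, by simpa using Lp_top_ae_norm_le (wderiv f j)⟩

theorem norm_wderiv_le_norm {r : ℕ} (f : WInf q r) (j : Fin (r + 1)) : ‖wderiv f j‖ ≤ ‖f‖ := by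
  rw [norm_def]
  exact Finset.single_le_sum (f := fun j => ‖wderiv f j‖) (fun i _ => norm_nonneg _)
    (Finset.mem_univ j)

theorem weighted_neg_weighted (q : ℝ) (u : ℝ → ℂ) : weighted (-q) (weighted q u) = u := by
  rw [weighted_weighted, neg_add_cancel, weighted_zero]

theorem expBdd_coe {r : ℕ} (f : WInf q r) : ExpBdd q ‖f‖ (f : ℝ →ₘ[volume] ℂ) := by
  have h := (((expBdd_wderiv f 0).mono (norm_wderiv_le_norm f 0)).congr
    (wderiv_zero_ae f)).weighted (-q)
  rwa [weighted_neg_weighted, zero_sub, neg_neg] at h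

theorem ExpBdd.weighted_self (hf : ExpBdd q M f) : ExpBdd 0 M (AdvanceDelay.weighted q f) := by
  simpa using hf.weighted q

theorem mem_LInf {f : ℝ →ₘ[volume] ℂ} (hf : ExpBdd q M f) : f ∈ LInf q := by
  refine ⟨hf.locallyIntegrable, fun j => ?_⟩
  obtain ⟨v, hv⟩ := hf.weighted_self.exists_Lp
  refine ⟨v, ?_⟩
  have hj : (j : ℕ) = 0 := by omega
  rw [hj]
  exact (isWeakDeriv_self hf.weighted_self.locallyIntegrable).congr (ae_eq_refl _) hv.symm

theorem norm_LInf_le (hM : 0 ≤ M) (f : LInf q) (hf : ExpBdd q M (f : ℝ →ₘ[volume] ℂ)) :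
    ‖f‖ ≤ M := by
  rw [norm_def, Fin.sum_univ_one]
  exact norm_wderiv_le f 0 hM (isWeakDeriv_self hf.weighted_self.locallyIntegrable)
    hf.weighted_self

variable {M₀ M₁ M₂ : ℝ} {f₁ f₂ : ℝ → ℂ}

/-- The second derivative of `e^{-qx} f` is `e^{-qx}(f'' - 2q f' + q² f)`; with `|q| ≤ 1` a single
constant bounds all three orders. -/
theorem isWeakDeriv_weighted_of_le_two {f : ℝ →ₘ[volume] ℂ} (hf : ExpBdd q M₀ f)
    (h₁ : ExpBdd q M₁ f₁) (h₂ : ExpBdd q M₂ f₂) (hM₀ : 0 ≤ M₀) (hM₁ : 0 ≤ M₁) (hM₂ : 0 ≤ M₂)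
    (hq : |q| ≤ 1) (hd₁ : IsWeakDeriv 1 f f₁) (hd₂ : IsWeakDeriv 2 f f₂) (j : Fin (2 + 1)) :
    ∃ v : ℝ → ℂ, IsWeakDeriv j (weighted q f) v ∧ ExpBdd 0 (M₂ + 2 * M₁ + M₀) v := by
  have nq : ‖(-q : ℂ)‖ ≤ 1 := by simpa using hq
  have b1 : ExpBdd q (M₁ + M₀) (f₁ + (-q : ℂ) • f) :=
    (h₁.add (hf.const_smul (-q : ℂ))).mono (by nlinarith)
  match j with
  | 0 => exact ⟨_, isWeakDeriv_self hf.weighted_self.locallyIntegrable,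
      hf.weighted_self.mono (by linarith)⟩
  | 1 => exact ⟨_, hd₁.weighted q, b1.weighted_self.mono (by linarith)⟩
  | 2 => exact ⟨_, hd₁.weighted_two hd₂ q,
      ((h₂.add (h₁.const_smul (-q : ℂ))).add (b1.const_smul (-q : ℂ))).weighted_self.mono
        (by nlinarith)⟩

theorem mem_WInf_two {f : ℝ →ₘ[volume] ℂ} (hf : ExpBdd q M₀ f)
    (h₁ : ExpBdd q M₁ f₁) (h₂ : ExpBdd q M₂ f₂) (hM₀ : 0 ≤ M₀) (hM₁ : 0 ≤ M₁) (hM₂ : 0 ≤ M₂)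
    (hq : |q| ≤ 1) (hd₁ : IsWeakDeriv 1 f f₁) (hd₂ : IsWeakDeriv 2 f f₂) : f ∈ WInf q 2 := by
  refine ⟨hf.locallyIntegrable, fun j => ?_⟩
  obtain ⟨v, hv, hb⟩ := isWeakDeriv_weighted_of_le_two hf h₁ h₂ hM₀ hM₁ hM₂ hq hd₁ hd₂ j
  obtain ⟨w, hw⟩ := hb.exists_Lp
  exact ⟨w, hv.congr (ae_eq_refl _) hw.symm⟩

theorem norm_WInf_two_le (f : WInf q 2) (hf : ExpBdd q M₀ (f : ℝ →ₘ[volume] ℂ))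
    (h₁ : ExpBdd q M₁ f₁) (h₂ : ExpBdd q M₂ f₂) (hM₀ : 0 ≤ M₀) (hM₁ : 0 ≤ M₁) (hM₂ : 0 ≤ M₂)
    (hq : |q| ≤ 1) (hd₁ : IsWeakDeriv 1 (f : ℝ →ₘ[volume] ℂ) f₁)
    (hd₂ : IsWeakDeriv 2 (f : ℝ →ₘ[volume] ℂ) f₂) :
    ‖f‖ ≤ 3 * (M₂ + 2 * M₁ + M₀) := by
  have h : ∀ j, ‖wderiv f j‖ ≤ M₂ + 2 * M₁ + M₀ := fun j => by
    obtain ⟨v, hv, hb⟩ := isWeakDeriv_weighted_of_le_two hf h₁ h₂ hM₀ hM₁ hM₂ hq hd₁ hd₂ j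
    exact norm_wderiv_le f j (by positivity) hv hb
  rw [norm_def, Fin.sum_univ_three]
  linarith [h 0, h 1, h 2]

/-- The weak derivatives of a function in `W_q^{2,∞}`, with exponential bounds. -/
theorem exists_isWeakDeriv_two (hq : |q| ≤ 1) (f : WInf q 2) :
    ∃ f₂ : ℝ → ℂ, IsWeakDeriv 2 (f : ℝ →ₘ[volume] ℂ) f₂ ∧ ExpBdd q (4 * ‖f‖) f₂ := by
  have hf := norm_nonneg f
  have e0 := ((expBdd_wderiv f 0).mono (norm_wderiv_le_norm f 0)).congr (wderiv_zero_ae f)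
  have e1 := (expBdd_wderiv f 1).mono (norm_wderiv_le_norm f 1)
  have e2 := (expBdd_wderiv f 2).mono (norm_wderiv_le_norm f 2)
  have h := IsWeakDeriv.weighted_two (wderiv_spec f 1) (wderiv_spec f 2) (-q)
  rw [weighted_neg_weighted] at h
  refine ⟨_, h, ?_⟩
  have hn : ‖(-((-q : ℝ) : ℂ))‖ ≤ 1 := by simpa using hq
  have := ((e2.add (e1.const_smul (-((-q : ℝ) : ℂ)))).add
    ((e1.add (e0.const_smul (-((-q : ℝ) : ℂ)))).const_smul (-((-q : ℝ) : ℂ)))).weighted (-q)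
  rw [zero_sub, neg_neg] at this
  have k1 := mul_le_of_le_one_left hf hn
  have k2 := mul_le_of_le_one_left (by positivity : 0 ≤ ‖f‖ + ‖(-((-q : ℝ) : ℂ))‖ * ‖f‖) hn
  exact this.mono (by linarith)

end AdvanceDelay
end

noncomputable section

namespace AdvanceDelay

open Filter Topology

/-! ### Convolution with exponentially decaying kernels -/

/-- `K` is measurable with `‖K y‖ ≤ A e^{q y - m |y|}`. -/
def KerBdd (q m A : ℝ) (K : ℝ → ℂ) : Prop :=
  Measurable K ∧ ∀ y, ‖K y‖ ≤ A * Real.exp (q * y - m * |y|)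

/-- The convolution `∫ K(x - s) h(s) ds`. -/
def convK (K h : ℝ → ℂ) (x : ℝ) : ℂ := ∫ s, K (x - s) * h s

/-- The adjoint `∫ K(x - s) φ(x) dx` of the convolution operator with kernel `K`. -/
def adjK (K φ : ℝ → ℂ) (s : ℝ) : ℂ := ∫ x, K (x - s) * φ x

theorem integral_exp_neg_mul_abs {m : ℝ} (hm : 0 < m) :
    ∫ y : ℝ, Real.exp (-(m * |y|)) = 2 / m := by
  rw [integral_comp_abs (f := fun y : ℝ => Real.exp (-(m * y)))]
  have := integral_exp_mul_Ioi (neg_neg_of_pos hm) 0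
  simp only [neg_mul] at this
  rw [this]
  simp [div_eq_mul_inv]

theorem integrable_exp_neg_mul_abs {m : ℝ} (hm : 0 < m) :
    Integrable fun y : ℝ => Real.exp (-(m * |y|)) := by
  -- A nonintegrable function has integral `0` by convention, whereas this integral equals `2/m`.
  refine not_imp_comm.1 integral_undef ?_
  rw [integral_exp_neg_mul_abs hm]
  positivity

variable {q m A M : ℝ} {K h : ℝ → ℂ}

/-- The weights `e^{q(x-s)}` and `e^{qs}` combine to `e^{qx}`, leaving `e^{-m|x-s|}` of mass `2/m`.
With `m = |q|` this is the only loss of a power of `ε`. -/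
theorem KerBdd.norm_mul_le (hK : KerBdd q m A K) (hA : 0 ≤ A) {a : ℂ} {x s : ℝ}
    (ha : ‖a‖ ≤ M * Real.exp (q * s)) :
    ‖K (x - s) * a‖ ≤ A * M * Real.exp (q * x) * Real.exp (-(m * |x - s|)) := by
  rw [norm_mul]
  calc ‖K (x - s)‖ * ‖a‖
      ≤ (A * Real.exp (q * (x - s) - m * |x - s|)) * (M * Real.exp (q * s)) := by
        gcongr
        exact hK.2 _
    _ = A * M * (Real.exp (q * (x - s) - m * |x - s|) * Real.exp (q * s)) := by ring
    _ = A * M * (Real.exp (q * x) * Real.exp (-(m * |x - s|))) := by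
        rw [← Real.exp_add, ← Real.exp_add]
        ring_nf
    _ = _ := by ring

theorem KerBdd.aestronglyMeasurable_prod (hK : KerBdd q m A K) (hh : AEStronglyMeasurable h) :
    AEStronglyMeasurable (fun p : ℝ × ℝ => K (p.1 - p.2) * h p.2)
      ((volume : Measure ℝ).prod volume) :=
  (hK.1.comp (measurable_fst.sub measurable_snd)).aestronglyMeasurable.mul
    (hh.comp_quasiMeasurePreserving Measure.quasiMeasurePreserving_snd)

theorem KerBdd.integrable_conv (hK : KerBdd q m A K) (hA : 0 ≤ A) (hm : 0 < m)
    (hh : ExpBdd q M h) (x : ℝ) : Integrable fun s => K (x - s) * h s := by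
  have hi := ((integrable_exp_neg_mul_abs hm).comp_sub_left x).const_mul
    (A * M * Real.exp (q * x))
  refine hi.mono' ?_ ?_
  · exact (hK.1.comp (measurable_const.sub measurable_id)).aestronglyMeasurable.mul hh.1
  · filter_upwards [hh.2] with s hs
    exact hK.norm_mul_le hA hs

theorem KerBdd.integral_norm_conv_le (hK : KerBdd q m A K) (hA : 0 ≤ A) (hm : 0 < m)
    (hh : ExpBdd q M h) (x : ℝ) :
    ∫ s, ‖K (x - s) * h s‖ ≤ A * M * (2 / m) * Real.exp (q * x) := by
  have hi := ((integrable_exp_neg_mul_abs hm).comp_sub_left x).const_mul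
    (A * M * Real.exp (q * x))
  calc ∫ s, ‖K (x - s) * h s‖
      ≤ ∫ s, A * M * Real.exp (q * x) * Real.exp (-(m * |x - s|)) := by
        refine integral_mono_ae (hK.integrable_conv hA hm hh x).norm hi ?_
        filter_upwards [hh.2] with s hs
        exact hK.norm_mul_le hA hs
    _ = _ := by
        rw [integral_const_mul, integral_sub_left_eq_self (fun y => Real.exp (-(m * |y|))),
          integral_exp_neg_mul_abs hm]
        ring

theorem KerBdd.norm_convK_le (hK : KerBdd q m A K) (hA : 0 ≤ A) (hm : 0 < m)
    (hh : ExpBdd q M h) (x : ℝ) :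
    ‖convK K h x‖ ≤ A * M * (2 / m) * Real.exp (q * x) :=
  (norm_integral_le_integral_norm _).trans (hK.integral_norm_conv_le hA hm hh x)

theorem KerBdd.expBdd_convK (hK : KerBdd q m A K) (hA : 0 ≤ A) (hm : 0 < m)
    (hh : ExpBdd q M h) : ExpBdd q (A * M * (2 / m)) (convK K h) :=
  ⟨(hK.aestronglyMeasurable_prod hh.1).integral_prod_right',
    Eventually.of_forall (hK.norm_convK_le hA hm hh)⟩

/-- This justifies Fubini in the duality between `convK` and `adjK`, and also makes `adjK K φ · h`
integrable although `adjK K φ` need not have compact support. -/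
theorem KerBdd.integrable_prod (hK : KerBdd q m A K) (hA : 0 ≤ A) (hm : 0 < m)
    (hh : ExpBdd q M h) {φ : ℝ → ℂ} (hφ : Continuous φ) (hs : HasCompactSupport φ) :
    Integrable (fun p : ℝ × ℝ => φ p.1 * (K (p.1 - p.2) * h p.2))
      ((volume : Measure ℝ).prod volume) := by
  have hmeas : AEStronglyMeasurable (fun p : ℝ × ℝ => φ p.1 * (K (p.1 - p.2) * h p.2))
      ((volume : Measure ℝ).prod volume) :=
    (hφ.comp continuous_fst).aestronglyMeasurable.mul (hK.aestronglyMeasurable_prod hh.1)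
  rw [integrable_prod_iff hmeas]
  refine ⟨Eventually.of_forall fun x => (hK.integrable_conv hA hm hh x).const_mul (φ x), ?_⟩
  have hb : Integrable fun x : ℝ => ‖φ x‖ * (A * M * (2 / m) * Real.exp (q * x)) :=
    Continuous.integrable_of_hasCompactSupport (by fun_prop) hs.norm.mul_right
  refine hb.mono' hmeas.norm.integral_prod_right' (Eventually.of_forall fun x => ?_)
  rw [Real.norm_of_nonneg (integral_nonneg fun _ => norm_nonneg _)]
  simp only [norm_mul (φ x)]
  rw [integral_const_mul]
  exact mul_le_mul_of_nonneg_left (hK.integral_norm_conv_le hA hm hh x) (norm_nonneg _)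

theorem adjK_mul (K φ h : ℝ → ℂ) (s : ℝ) :
    ∫ x, φ x * (K (x - s) * h s) = adjK K φ s * h s := by
  rw [adjK, ← integral_mul_const]
  refine integral_congr_ae (Eventually.of_forall fun x => ?_)
  dsimp only
  ring

theorem KerBdd.integrable_adjK_mul (hK : KerBdd q m A K) (hA : 0 ≤ A) (hm : 0 < m)
    (hh : ExpBdd q M h) {φ : ℝ → ℂ} (hφ : Continuous φ) (hs : HasCompactSupport φ) :
    Integrable fun s => adjK K φ s * h s := by
  have := (hK.integrable_prod hA hm hh hφ hs).integral_prod_right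
  simpa only [adjK_mul] using this

theorem KerBdd.integral_mul_convK (hK : KerBdd q m A K) (hA : 0 ≤ A) (hm : 0 < m)
    (hh : ExpBdd q M h) {φ : ℝ → ℂ} (hφ : Continuous φ) (hs : HasCompactSupport φ) :
    ∫ x, φ x * convK K h x = ∫ s, adjK K φ s * h s := by
  have := integral_integral_swap (f := fun x s => φ x * (K (x - s) * h s))
    (hK.integrable_prod hA hm hh hφ hs)
  simpa only [adjK_mul, integral_const_mul, convK] using this

theorem KerBdd.locallyIntegrable (hK : KerBdd q m A K) : LocallyIntegrable K := by
  have hc : Continuous fun y : ℝ => A * Real.exp (q * y - m * |y|) := by fun_prop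
  refine hc.locallyIntegrable.mono hK.1.aestronglyMeasurable (Eventually.of_forall fun y => ?_)
  exact (hK.2 y).trans (le_abs_self _)

theorem KerBdd.comp_neg (hK : KerBdd q m A K) : KerBdd (-q) m A fun y => K (-y) :=
  ⟨hK.1.comp measurable_neg, fun y => by simpa using hK.2 (-y)⟩

theorem adjK_eq_convolution (K φ : ℝ → ℂ) :
    adjK K φ = convolution (fun y => K (-y)) φ (ContinuousLinearMap.mul ℝ ℂ) volume := by
  ext s
  rw [adjK, convolution_def, ← integral_sub_left_eq_self _ volume s]
  refine integral_congr_ae (Eventually.of_forall fun x => ?_)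
  simp

theorem KerBdd.contDiff_adjK (hK : KerBdd q m A K) {φ : ℝ → ℂ} (hφ : ContDiff ℝ ∞ φ)
    (hs : HasCompactSupport φ) : ContDiff ℝ ∞ (adjK K φ) := by
  rw [adjK_eq_convolution]
  exact hs.contDiff_convolution_right _ hK.comp_neg.locallyIntegrable hφ

theorem KerBdd.deriv_adjK (hK : KerBdd q m A K) {φ : ℝ → ℂ} (hφ : ContDiff ℝ ∞ φ)
    (hs : HasCompactSupport φ) : deriv (adjK K φ) = adjK K (deriv φ) := by
  ext s
  rw [adjK_eq_convolution, adjK_eq_convolution]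
  exact (hs.hasDerivAt_convolution_right _ hK.comp_neg.locallyIntegrable
    (hφ.of_le (by exact_mod_cast le_top)) s).deriv

theorem adjK_comp_add (K φ : ℝ → ℂ) (d s : ℝ) :
    adjK K (fun x => φ (x + d)) s = adjK K φ (s + d) := by
  rw [adjK, adjK, ← integral_add_right_eq_self (fun x => K (x - (s + d)) * φ x) d]
  refine integral_congr_ae (Eventually.of_forall fun x => ?_)
  simp

/-! ### From the second weak derivative to the first -/

/-- The kernel of the remainder in Taylor's formula of second order. -/
def taylorKer (y : ℝ) : ℂ := (Set.Icc (0 : ℝ) 1).indicator (fun y => ((1 - y : ℝ) : ℂ)) y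

theorem kerBdd_taylorKer (hq : |q| ≤ 1) : KerBdd q 1 (Real.exp 2) taylorKer := by
  refine ⟨Measurable.indicator (by fun_prop) measurableSet_Icc, fun y => ?_⟩
  by_cases hy : y ∈ Set.Icc (0 : ℝ) 1
  · rw [taylorKer, Set.indicator_of_mem hy, Complex.norm_real, Real.norm_eq_abs,
      abs_of_nonneg (by linarith [hy.2]), ← Real.exp_add, abs_of_nonneg hy.1]
    -- The prefactor `e²` compensates the weight on the support `[0, 1]`, where `(1 - q) y ≤ 2`.
    have h1 : 0 ≤ 2 + (q * y - 1 * y) := by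
      have := (abs_le.1 hq).1
      nlinarith [hy.1, hy.2]
    linarith [Real.one_le_exp h1, hy.1]
  · rw [taylorKer, Set.indicator_of_notMem hy, norm_zero]
    positivity

theorem adjK_taylorKer (φ : ℝ → ℂ) (s : ℝ) :
    adjK taylorKer φ s = ∫ y in (0 : ℝ)..1, ((1 - y : ℝ) : ℂ) * φ (y + s) := by
  rw [adjK, ← integral_add_right_eq_self _ s, intervalIntegral.integral_of_le zero_le_one,
    ← integral_Icc_eq_integral_Ioc, ← integral_indicator measurableSet_Icc]
  refine integral_congr_ae (Eventually.of_forall fun y => ?_)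
  simp only [add_sub_cancel_right, taylorKer, Set.indicator_apply]
  split_ifs <;> simp

theorem adjK_taylorKer_deriv_deriv {φ : ℝ → ℂ} (hφ : ContDiff ℝ ∞ φ) (s : ℝ) :
    adjK taylorKer (deriv (deriv φ)) s = φ (s + 1) - φ s - deriv φ s := by
  have hφ' : ContDiff ℝ ∞ (deriv φ) := (contDiff_infty_iff_deriv.1 hφ).2
  have hφ'' : ContDiff ℝ ∞ (deriv (deriv φ)) := (contDiff_infty_iff_deriv.1 hφ').2
  have hd : ∀ ψ : ℝ → ℂ, ContDiff ℝ ∞ ψ → ∀ y : ℝ,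
      HasDerivAt (fun y => ψ (y + s)) (deriv ψ (y + s)) y := fun ψ hψ y =>
    ((hψ.differentiable (by simp) (y + s)).hasDerivAt).comp_add_const y s
  have hF : ∀ y : ℝ, HasDerivAt (fun y : ℝ => ((1 - y : ℝ) : ℂ) * deriv φ (y + s) + φ (y + s))
      (((1 - y : ℝ) : ℂ) * deriv (deriv φ) (y + s)) y := fun y => by
    have h1 : HasDerivAt (fun y : ℝ => ((1 - y : ℝ) : ℂ)) ((-1 : ℝ) : ℂ) y :=
      ((hasDerivAt_id y).const_sub 1).ofReal_comp
    refine ((h1.mul (hd _ hφ' y)).add (hd _ hφ y)).congr_deriv ?_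
    push_cast
    ring
  have hc : Continuous fun y : ℝ => ((1 - y : ℝ) : ℂ) * deriv (deriv φ) (y + s) := by
    have := hφ''.continuous
    fun_prop
  rw [adjK_taylorKer, intervalIntegral.integral_eq_sub_of_hasDerivAt (fun y _ => hF y)
    (hc.intervalIntegrable _ _)]
  simp only [sub_self, Complex.ofReal_zero, zero_mul, zero_add, sub_zero, Complex.ofReal_one,
    one_mul, add_comm 1 s]
  ring

theorem hasCompactSupport_adjK_taylorKer {φ : ℝ → ℂ} (hs : HasCompactSupport φ) :
    HasCompactSupport (adjK taylorKer φ) := by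
  rw [adjK_eq_convolution]
  refine HasCompactSupport.convolution _ ?_ hs
  refine HasCompactSupport.of_support_subset_isCompact (K := Set.Icc (-1 : ℝ) 0) isCompact_Icc ?_
  intro y hy
  by_contra hn
  refine hy ?_
  simp only [taylorKer]
  refine Set.indicator_of_notMem (fun h => hn ⟨?_, ?_⟩) _
  · linarith [h.2]
  · linarith [h.1]

theorem integral_mul_comp_add {φ f : ℝ → ℂ} (d : ℝ) :
    ∫ x, φ (x + d) * f x = ∫ x, φ x * f (x + -d) := by
  rw [← integral_add_right_eq_self (fun x => φ x * f (x + -d)) d]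
  refine integral_congr_ae (Eventually.of_forall fun x => ?_)
  simp

theorem contDiff_ofReal_comp {φ : ℝ → ℝ} (hφ : ContDiff ℝ ∞ φ) :
    ContDiff ℝ ∞ fun x => (φ x : ℂ) :=
  Complex.ofRealCLM.contDiff.comp hφ

theorem hasCompactSupport_ofReal_comp {φ : ℝ → ℝ} (hs : HasCompactSupport φ) :
    HasCompactSupport fun x => (φ x : ℂ) :=
  hs.comp_left Complex.ofReal_zero

theorem deriv_ofReal_comp {φ : ℝ → ℝ} (hφ : ContDiff ℝ ∞ φ) :
    deriv (fun x => (φ x : ℂ)) = fun x => ((deriv φ x : ℝ) : ℂ) := by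
  ext x
  exact ((hφ.differentiable (by simp) x).hasDerivAt.ofReal_comp).deriv

/-- The defining identity of the second weak derivative holds for complex test functions. -/
theorem IsWeakDeriv.integral_deriv_deriv_mul {u v : ℝ → ℂ} (h : IsWeakDeriv 2 u v) {φ : ℝ → ℂ}
    (hφ : ContDiff ℝ ∞ φ) (hs : HasCompactSupport φ) :
    ∫ x, deriv (deriv φ) x * u x = ∫ x, φ x * v x := by
  have hφ' : ContDiff ℝ ∞ (deriv φ) := (contDiff_infty_iff_deriv.1 hφ).2
  -- Weak derivatives are defined by real test functions, so `φ` is split into real and imaginary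
  -- parts.
  have key : ∀ L : ℂ →L[ℝ] ℝ, ∫ x, L (deriv (deriv φ) x) • u x = ∫ x, L (φ x) • v x := fun L => by
    have hL : ContDiff ℝ ∞ fun x => L (φ x) := L.contDiff.comp hφ
    have hLs : HasCompactSupport fun x => L (φ x) := hs.comp_left (map_zero L)
    have hd : ∀ ψ : ℝ → ℂ, ContDiff ℝ ∞ ψ → deriv (fun x => L (ψ x)) = fun x => L (deriv ψ x) :=
      fun ψ hψ => by
        ext x
        exact (L.hasFDerivAt.comp_hasDerivAt x (hψ.differentiable (by simp) x).hasDerivAt).deriv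
    have h1 := h.2.2 _ hL hLs
    rw [iteratedDeriv_succ, iteratedDeriv_one, hd φ hφ, hd _ hφ'] at h1
    rw [h1]
    ring
  have split : ∀ (ψ w : ℝ → ℂ), LocallyIntegrable w → Continuous ψ → HasCompactSupport ψ →
      ∫ x, ψ x * w x = (∫ x, Complex.reCLM (ψ x) • w x) +
        Complex.I * ∫ x, Complex.imCLM (ψ x) • w x := fun ψ w hw hψ hψs => by
    have i1 : Integrable fun x => Complex.reCLM (ψ x) • w x :=
      hw.integrable_smul_left_of_hasCompactSupport (Complex.reCLM.continuous.comp hψ)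
        (hψs.comp_left (map_zero _))
    have i2 : Integrable fun x => Complex.imCLM (ψ x) • w x :=
      hw.integrable_smul_left_of_hasCompactSupport (Complex.imCLM.continuous.comp hψ)
        (hψs.comp_left (map_zero _))
    rw [← integral_const_mul, ← integral_add i1 (i2.const_mul _)]
    refine integral_congr_ae (Eventually.of_forall fun x => ?_)
    simp only [Complex.reCLM_apply, Complex.imCLM_apply, Complex.real_smul]
    nth_rewrite 1 [← Complex.re_add_im (ψ x)]
    ring
  rw [split _ _ h.1 (contDiff_infty_iff_deriv.1 hφ').2.continuous hs.deriv.deriv,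
    split _ _ h.2.1 hφ.continuous hs, key, key]

variable {M₀ M₂ : ℝ} {f f₂ : ℝ → ℂ}

theorem exp_le_three {x : ℝ} (hx : x ≤ 1) : Real.exp x ≤ 3 :=
  (Real.exp_le_exp.2 hx).trans (Real.exp_one_lt_d9.le.trans (by norm_num))

/-- Landau's inequality: bounds for a function and its second weak derivative give the first
weak derivative and a bound for it. -/
theorem IsWeakDeriv.exists_one (h : IsWeakDeriv 2 f f₂) (hq : |q| ≤ 1) (hf : ExpBdd q M₀ f)
    (hf₂ : ExpBdd q M₂ f₂) (hM₀ : 0 ≤ M₀) (hM₂ : 0 ≤ M₂) :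
    ∃ f₁, IsWeakDeriv 1 f f₁ ∧ ExpBdd q (4 * M₀ + 18 * M₂) f₁ := by
  have hK := kerBdd_taylorKer hq
  have hA : 0 ≤ Real.exp 2 := (Real.exp_pos 2).le
  have hconv := hK.expBdd_convK hA one_pos hf₂
  have hsh := hf.comp_add_right (-1)
  -- The candidate is `f₁ = f - f(· - 1) + taylorKer * f₂`, Taylor's formula solved for `f'`. It is
  -- verified by testing `f₂` against `adjK taylorKer Φ`, whose second derivative is `Φ(· + 1) - Φ -
  -- Φ'`.
  have hb := (hf.add (hsh.const_smul (-1))).add hconv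
  refine ⟨_, ⟨hf.locallyIntegrable, hb.locallyIntegrable, fun φ hφ hs => ?_⟩, hb.mono ?_⟩
  · set Φ : ℝ → ℂ := fun x => (φ x : ℂ) with hΦ
    have hΦc : ContDiff ℝ ∞ Φ := contDiff_ofReal_comp hφ
    have hΦs : HasCompactSupport Φ := hasCompactSupport_ofReal_comp hs
    have hΦ' : ContDiff ℝ ∞ (deriv Φ) := (contDiff_infty_iff_deriv.1 hΦc).2
    have h1 := h.integral_deriv_deriv_mul (hK.contDiff_adjK hΦc hΦs)
      (hasCompactSupport_adjK_taylorKer hΦs)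
    rw [hK.deriv_adjK hΦc hΦs, hK.deriv_adjK hΦ' hΦs.deriv,
      ← hK.integral_mul_convK hA one_pos hf₂ hΦc.continuous hΦs] at h1
    simp only [adjK_taylorKer_deriv_deriv hΦc] at h1
    have int : ∀ {ψ w : ℝ → ℂ}, LocallyIntegrable w → Continuous ψ → HasCompactSupport ψ →
        Integrable fun x => ψ x * w x := fun hw hψ hψs =>
      hw.integrable_smul_left_of_hasCompactSupport hψ hψs
    have hΦ1 : HasCompactSupport fun x => Φ (x + 1) :=
      hΦs.comp_homeomorph (Homeomorph.addRight (1 : ℝ))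
    have j0 := int hf.locallyIntegrable hΦc.continuous hΦs
    have j1 : Integrable fun x => Φ (x + 1) * f x := int hf.locallyIntegrable
      (hΦc.continuous.comp (continuous_id.add continuous_const)) hΦ1
    have j2 := int hf.locallyIntegrable hΦ'.continuous hΦs.deriv
    have j3 := int hsh.locallyIntegrable hΦc.continuous hΦs
    have j4 := int hconv.locallyIntegrable hΦc.continuous hΦs
    have j5 : Integrable fun x => Φ (x + 1) * f x - Φ x * f x := j1.sub j0
    have j6 : Integrable fun x => Φ x * f x - Φ x * f (x + -1) := j0.sub j3
    have h2 : ∫ x, (Φ (x + 1) - Φ x - deriv Φ x) * f x =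
        (∫ x, Φ x * f (x + -1)) - (∫ x, Φ x * f x) - ∫ x, deriv Φ x * f x := by
      rw [← integral_mul_comp_add, ← integral_sub j1 j0, ← integral_sub j5 j2]
      refine integral_congr_ae (Eventually.of_forall fun x => ?_)
      ring
    have h3 : ∫ x, φ x • (f + (-1 : ℂ) • (fun x => f (x + -1)) + convK taylorKer f₂) x =
        (∫ x, Φ x * f x) - (∫ x, Φ x * f (x + -1)) + ∫ x, Φ x * convK taylorKer f₂ x := by
      rw [← integral_sub j0 j3, ← integral_add j6 j4]
      refine integral_congr_ae (Eventually.of_forall fun x => ?_)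
      simp only [Pi.add_apply, Pi.smul_apply, Complex.real_smul, smul_eq_mul, hΦ]
      ring
    have h4 : ∫ x, iteratedDeriv 1 φ x • f x = ∫ x, deriv Φ x * f x := by
      rw [iteratedDeriv_one, hΦ, deriv_ofReal_comp hφ]
      simp only [Complex.real_smul]
    rw [h3, h4]
    rw [h2] at h1
    linear_combination -h1
  · have e1 : Real.exp (q * -1) ≤ 3 := exp_le_three (by linarith [(abs_le.1 hq).1])
    have e2 : Real.exp 2 ≤ 9 := by
      rw [show (2 : ℝ) = 1 + 1 by norm_num, Real.exp_add]
      nlinarith [exp_le_three le_rfl, Real.exp_pos 1]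
    rw [norm_neg, norm_one]
    nlinarith [mul_le_mul_of_nonneg_right e1 hM₀, mul_le_mul_of_nonneg_right e2 hM₂]

end AdvanceDelay
end

noncomputable section

namespace AdvanceDelay

open Filter Topology

/-! ### The operator on smooth functions and its fundamental solution -/

/-- `B_c` applied to a smooth function. -/
def opB (c : ℝ) (φ : ℝ → ℂ) (x : ℝ) : ℂ :=
  (c : ℂ) ^ 2 * deriv (deriv φ) x + 2 * φ x + φ (x + 1) + φ (x + -1)

theorem contDiff_infty_deriv {φ : ℝ → ℂ} (hφ : ContDiff ℝ ∞ φ) : ContDiff ℝ ∞ (deriv φ) :=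
  (contDiff_infty_iff_deriv.1 hφ).2

theorem hasCompactSupport_comp_add {φ : ℝ → ℂ} (hs : HasCompactSupport φ) (d : ℝ) :
    HasCompactSupport fun x => φ (x + d) :=
  hs.comp_homeomorph (Homeomorph.addRight d)

theorem continuous_comp_add {φ : ℝ → ℂ} (hφ : Continuous φ) (d : ℝ) :
    Continuous fun x => φ (x + d) :=
  hφ.comp (continuous_id.add continuous_const)

theorem continuous_opB (c : ℝ) {φ : ℝ → ℂ} (hφ : ContDiff ℝ ∞ φ) : Continuous (opB c φ) := by
  have h0 := hφ.continuous
  have h2 := (contDiff_infty_deriv (contDiff_infty_deriv hφ)).continuous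
  unfold opB
  fun_prop

theorem hasCompactSupport_opB (c : ℝ) {φ : ℝ → ℂ} (hs : HasCompactSupport φ) :
    HasCompactSupport (opB c φ) :=
  ((hs.deriv.deriv.mul_left.add hs.mul_left).add (hasCompactSupport_comp_add hs 1)).add
    (hasCompactSupport_comp_add hs (-1))

theorem integrable_continuous_mul {ψ w : ℝ → ℂ} (hw : LocallyIntegrable w) (hψ : Continuous ψ)
    (hs : HasCompactSupport ψ) : Integrable fun x => ψ x * w x :=
  hw.integrable_smul_left_of_hasCompactSupport hψ hs

/-- Expansion of the pairing of `B_c φ` with a locally integrable function. -/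
theorem integral_opB_mul (c : ℝ) {φ w : ℝ → ℂ} (hφ : ContDiff ℝ ∞ φ) (hs : HasCompactSupport φ)
    (hw : LocallyIntegrable w) : ∫ x, opB c φ x * w x =
      (c : ℂ) ^ 2 * (∫ x, deriv (deriv φ) x * w x) + 2 * (∫ x, φ x * w x) +
        (∫ x, φ (x + 1) * w x) + ∫ x, φ (x + -1) * w x := by
  have i1 := (integrable_continuous_mul hw
    (contDiff_infty_deriv (contDiff_infty_deriv hφ)).continuous hs.deriv.deriv).const_mul ((c : ℂ) ^ 2)
  have i2 := (integrable_continuous_mul hw hφ.continuous hs).const_mul 2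
  have i3 := integrable_continuous_mul hw (continuous_comp_add hφ.continuous 1)
    (hasCompactSupport_comp_add hs 1)
  have i4 := integrable_continuous_mul hw (continuous_comp_add hφ.continuous (-1))
    (hasCompactSupport_comp_add hs (-1))
  have i12 : Integrable fun x => (c : ℂ) ^ 2 * (deriv (deriv φ) x * w x) + 2 * (φ x * w x) :=
    i1.add i2
  have i123 : Integrable fun x => (c : ℂ) ^ 2 * (deriv (deriv φ) x * w x) + 2 * (φ x * w x) +
    φ (x + 1) * w x := i12.add i3
  rw [← integral_const_mul, ← integral_const_mul, ← integral_add i1 i2, ← integral_add i12 i3,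
    ← integral_add i123 i4]
  refine integral_congr_ae (Eventually.of_forall fun x => ?_)
  simp only [opB]
  ring

theorem continuous_exp_ofReal_mul (z : ℂ) : Continuous fun x : ℝ => Complex.exp (x * z) := by
  fun_prop

theorem integral_deriv_mul_exp {φ : ℝ → ℂ} (hφ : ContDiff ℝ ∞ φ) (hs : HasCompactSupport φ)
    (z : ℂ) : ∫ x : ℝ, deriv φ x * Complex.exp (x * z) =
      -z * ∫ x : ℝ, φ x * Complex.exp (x * z) := by
  have hw := (continuous_exp_ofReal_mul z).locallyIntegrable (μ := volume)
  have hE : ∀ x : ℝ, HasDerivAt (fun x : ℝ => Complex.exp (x * z)) (z * Complex.exp (x * z)) x :=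
    fun x => by
      have h1 : HasDerivAt (fun x : ℝ => (x : ℂ) * z) (1 * z) x :=
        (Complex.ofRealCLM.hasDerivAt (x := x)).mul_const z
      refine h1.cexp.congr_deriv ?_
      ring
  have hw' : LocallyIntegrable fun x : ℝ => z * Complex.exp (x * z) :=
    (continuous_const.mul (continuous_exp_ofReal_mul z)).locallyIntegrable
  have := integral_mul_deriv_eq_deriv_mul_of_integrable (u := φ) (u' := deriv φ)
    (v := fun x : ℝ => Complex.exp (x * z)) (v' := fun x => z * Complex.exp (x * z))
    (fun x _ => (hφ.differentiable (by simp) x).hasDerivAt) (fun x _ => hE x)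
    (integrable_continuous_mul hw' hφ.continuous hs)
    (integrable_continuous_mul hw (contDiff_infty_deriv hφ).continuous hs.deriv)
    (integrable_continuous_mul hw hφ.continuous hs)
  rw [eq_neg_iff_add_eq_zero] at this
  rw [neg_mul, eq_neg_iff_add_eq_zero, add_comm, ← this, ← integral_const_mul]
  congr 1
  refine integral_congr_ae (Eventually.of_forall fun x => ?_)
  dsimp only
  ring

theorem integral_comp_add_mul_exp (φ : ℝ → ℂ) (d : ℝ) (z : ℂ) :
    ∫ x : ℝ, φ (x + d) * Complex.exp (x * z) =
      Complex.exp (-(d * z)) * ∫ x : ℝ, φ x * Complex.exp (x * z) := by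
  rw [integral_mul_comp_add (f := fun x : ℝ => Complex.exp (x * z)), ← integral_const_mul]
  refine integral_congr_ae (Eventually.of_forall fun x => ?_)
  dsimp only
  rw [mul_left_comm, ← Complex.exp_add]
  congr 2
  push_cast
  ring

/-- `B_c` is formally symmetric: two integrations by parts give `z²`, and the two shifts together
give `2 cosh z`. -/
theorem integral_opB_mul_exp (c : ℝ) {φ : ℝ → ℂ} (hφ : ContDiff ℝ ∞ φ) (hs : HasCompactSupport φ)
    (z : ℂ) : ∫ x : ℝ, opB c φ x * Complex.exp (x * z) =
      charFun c z * ∫ x : ℝ, φ x * Complex.exp (x * z) := by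
  rw [integral_opB_mul c hφ hs (continuous_exp_ofReal_mul z).locallyIntegrable,
    integral_deriv_mul_exp (contDiff_infty_deriv hφ) hs.deriv, integral_deriv_mul_exp hφ hs,
    integral_comp_add_mul_exp, integral_comp_add_mul_exp, charFun, Complex.cosh]
  push_cast
  rw [one_mul, show -(-1 * z) = z by ring]
  ring

/-- Inversion of the bilateral Laplace transform of a test function. -/
theorem integral_laplace_inversion {φ : ℝ → ℂ} (hφ : ContDiff ℝ ∞ φ) (hs : HasCompactSupport φ)
    (q s : ℝ) : ∫ t : ℝ, ∫ x : ℝ, φ x * Complex.exp ((x - s : ℝ) * vline q t) =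
      2 * Real.pi * φ s := by
  open FourierTransform in
  set F : ℝ → ℂ := fun x => φ x * Complex.exp (((x - s : ℝ) : ℂ) * q) with hF
  have hFc : ContDiff ℝ ∞ F := by
    refine hφ.mul ?_
    have h1 : ContDiff ℝ ∞ fun x : ℝ => (x - s) * q := by fun_prop
    simpa using (contDiff_ofReal_comp h1).cexp
  have hFs : HasCompactSupport F := hs.mul_right
  have hinv : 𝓕⁻ (𝓕 F) s = F s := by
    have h1 := FourierPair.fourierInv_fourier_eq (F := SchwartzMap ℝ ℂ)
      (hFs.toSchwartzMap hFc)
    have h2 := congrArg (fun f => f s) h1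
    rw [SchwartzMap.fourierInv_coe, SchwartzMap.fourier_coe] at h2
    exact h2
  set H : ℝ → ℂ := fun t => ∫ x : ℝ, φ x * Complex.exp ((x - s : ℝ) * vline q t) with hH
  have hFs' : F s = φ s := by simp [hF]
  -- The height on the contour is `t = -2πξ`; the factor `2π` in the statement is the Jacobian of
  -- this substitution.
  have key : 𝓕⁻ (𝓕 F) s = ∫ ξ : ℝ, H ((-(2 * Real.pi)) * ξ) := by
    rw [Real.fourierInv_eq']
    refine integral_congr_ae (Eventually.of_forall fun ξ => ?_)
    simp only [hH]
    rw [Real.fourier_eq', smul_eq_mul, ← integral_const_mul]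
    refine integral_congr_ae (Eventually.of_forall fun x => ?_)
    simp only [hF, smul_eq_mul, vline]
    rw [mul_left_comm (Complex.exp _) (φ x), mul_left_comm (Complex.exp _) (φ x), ← Complex.exp_add,
      ← Complex.exp_add]
    congr 2
    simp only [RCLike.inner_apply, conj_trivial]
    push_cast
    ring
  rw [hinv, hFs', Measure.integral_comp_mul_left] at key
  rw [key, abs_inv, abs_neg, abs_of_pos (by positivity), Complex.real_smul]
  push_cast
  field_simp

variable {c q : ℝ}

/-- The Green's function is a fundamental solution of `B_c`. -/
theorem adjK_green_opB (hc : 1 ≤ c) (hq : |q| ≤ 1 / 4) (h0 : q ≠ 0) {φ : ℝ → ℂ}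
    (hφ : ContDiff ℝ ∞ φ) (hs : HasCompactSupport φ) :
    adjK (green c q) (opB c φ) = φ := by
  ext s
  set χ := opB c φ with hχ
  have hχc : Continuous χ := continuous_opB c hφ
  have hχs : HasCompactSupport χ := hasCompactSupport_opB c hs
  have hprod : Integrable (Function.uncurry fun (x t : ℝ) =>
      kernelK c (x - s) (vline q t) * χ x) ((volume : Measure ℝ).prod volume) := by
    have h1 : Integrable fun x : ℝ => ‖χ x‖ * (400 / |q| * Real.exp ((x - s) * q)) :=
      Continuous.integrable_of_hasCompactSupport (by fun_prop) hχs.norm.mul_right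
    have h2 := h1.mul_prod (integrable_const_div_one_add_sq 1)
    refine h2.mono' ?_ (Eventually.of_forall fun p => ?_)
    · have hcont : Continuous fun p : ℝ × ℝ => kernelK c (p.1 - s) (vline q p.2) :=
        (continuous_kernelK_vline hc hq h0).comp
          ((continuous_fst.sub continuous_const).prodMk continuous_snd)
      exact (hcont.mul (hχc.comp continuous_fst)).aestronglyMeasurable
    · simp only [Function.uncurry, norm_mul]
      have h3 := norm_kernelK_le hc hq h0 (p.1 - s) p.2
      calc ‖kernelK c (p.1 - s) (vline q p.2)‖ * ‖χ p.1‖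
          ≤ (400 / |q| * Real.exp ((p.1 - s) * q)) / (1 + p.2 ^ 2) * ‖χ p.1‖ := by gcongr
        _ = _ := by ring
  have e1 : adjK (green c q) χ s =
      (2 * Real.pi : ℂ)⁻¹ * ∫ x : ℝ, ∫ t : ℝ, kernelK c (x - s) (vline q t) * χ x := by
    rw [adjK, ← integral_const_mul]
    refine integral_congr_ae (Eventually.of_forall fun x => ?_)
    simp only [green, contourIntegral, integral_mul_const]
    have := Complex.I_ne_zero
    have hpi : (Real.pi : ℂ) ≠ 0 := Complex.ofReal_ne_zero.2 Real.pi_ne_zero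
    field_simp
  -- The symbol produced by `opB` cancels the denominator of the kernel, leaving plain Laplace
  -- inversion of `φ`.
  have e2 : ∀ t : ℝ, ∫ x : ℝ, kernelK c (x - s) (vline q t) * χ x =
      ∫ x : ℝ, φ x * Complex.exp ((x - s : ℝ) * vline q t) := fun t => by
    have hp := charFun_ne_zero (t := t) hc hq h0
    have h1 := integral_opB_mul_exp c hφ hs (vline q t)
    have h2 : ∀ ψ : ℝ → ℂ, ∫ x : ℝ, ψ x * Complex.exp ((x - s : ℝ) * vline q t) =
        Complex.exp (-(s * vline q t)) * ∫ x : ℝ, ψ x * Complex.exp (x * vline q t) := fun ψ => by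
      rw [← integral_const_mul]
      refine integral_congr_ae (Eventually.of_forall fun x => ?_)
      dsimp only
      rw [mul_left_comm, ← Complex.exp_add]
      congr 2
      push_cast
      ring
    have h3 : ∫ x : ℝ, kernelK c (x - s) (vline q t) * χ x =
        (charFun c (vline q t))⁻¹ * ∫ x : ℝ, χ x * Complex.exp ((x - s : ℝ) * vline q t) := by
      rw [← integral_const_mul]
      refine integral_congr_ae (Eventually.of_forall fun x => ?_)
      simp only [kernelK_eq]
      field_simp
    rw [h3, h2, h2, h1]
    field_simp
  rw [e1, integral_integral_swap hprod]
  simp only [e2]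
  rw [integral_laplace_inversion hφ hs]
  have hpi : (Real.pi : ℂ) ≠ 0 := Complex.ofReal_ne_zero.2 Real.pi_ne_zero
  field_simp

end AdvanceDelay
end

noncomputable section

namespace AdvanceDelay

open Filter Topology

/-! ### Weak formulation of the equation `B_c f = g` -/

variable {c q M N : ℝ}

/-- Moving the shifts from the test function back onto `f` lets the equation be solved for `c² f''`,
so no derivative of the kernel is ever needed. -/
theorem isWeakDeriv_two_of_integral_opB {f g : ℝ → ℂ} (hc : c ≠ 0) (hf : ExpBdd q M f)
    (hg : ExpBdd q N g)
    (h : ∀ φ : ℝ → ℂ, ContDiff ℝ ∞ φ → HasCompactSupport φ →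
      ∫ x, opB c φ x * f x = ∫ x, φ x * g x) :
    IsWeakDeriv 2 f (((c : ℂ) ^ 2)⁻¹ • (g + (-2 : ℂ) • f + (-1 : ℂ) • (fun x => f (x + 1)) +
      (-1 : ℂ) • fun x => f (x + -1))) := by
  have hs1 := hf.comp_add_right 1
  have hs2 := hf.comp_add_right (-1)
  have hb := (((hg.add (hf.const_smul (-2 : ℂ))).add (hs1.const_smul (-1))).add
    (hs2.const_smul (-1))).const_smul ((c : ℂ) ^ 2)⁻¹
  refine ⟨hf.locallyIntegrable, hb.locallyIntegrable, fun φ hφ hs => ?_⟩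
  set Φ : ℝ → ℂ := fun x => (φ x : ℂ) with hΦ
  have hΦc : ContDiff ℝ ∞ Φ := contDiff_ofReal_comp hφ
  have hΦs : HasCompactSupport Φ := hasCompactSupport_ofReal_comp hs
  have h1 := h Φ hΦc hΦs
  rw [integral_opB_mul c hΦc hΦs hf.locallyIntegrable, integral_mul_comp_add,
    integral_mul_comp_add, neg_neg] at h1
  have i0 := integrable_continuous_mul hg.locallyIntegrable hΦc.continuous hΦs
  have i1 := (integrable_continuous_mul hf.locallyIntegrable hΦc.continuous hΦs).const_mul 2
  have i2 := integrable_continuous_mul hs1.locallyIntegrable hΦc.continuous hΦs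
  have i3 := integrable_continuous_mul hs2.locallyIntegrable hΦc.continuous hΦs
  have i01 : Integrable fun x => Φ x * g x - 2 * (Φ x * f x) := i0.sub i1
  have i012 : Integrable fun x => Φ x * g x - 2 * (Φ x * f x) - Φ x * f (x + 1) := i01.sub i2
  have hc2 : (c : ℂ) ^ 2 ≠ 0 := pow_ne_zero 2 (Complex.ofReal_ne_zero.2 hc)
  have e1 : ∫ x, φ x • (((c : ℂ) ^ 2)⁻¹ • (g + (-2 : ℂ) • f + (-1 : ℂ) • (fun x => f (x + 1)) +
      (-1 : ℂ) • fun x => f (x + -1))) x = ((c : ℂ) ^ 2)⁻¹ * ((∫ x, Φ x * g x) -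
        2 * (∫ x, Φ x * f x) - (∫ x, Φ x * f (x + 1)) - ∫ x, Φ x * f (x + -1)) := by
    rw [← integral_const_mul 2, ← integral_sub i0 i1, ← integral_sub i01 i2,
      ← integral_sub i012 i3, ← integral_const_mul]
    refine integral_congr_ae (Eventually.of_forall fun x => ?_)
    simp only [Pi.add_apply, Pi.smul_apply, Complex.real_smul, smul_eq_mul, hΦ]
    ring
  have e2 : ∫ x, iteratedDeriv 2 φ x • f x = ∫ x, deriv (deriv Φ) x * f x := by
    have hφ' : ContDiff ℝ ∞ (deriv φ) := (contDiff_infty_iff_deriv.1 hφ).2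
    rw [iteratedDeriv_succ, iteratedDeriv_one, hΦ, deriv_ofReal_comp hφ, deriv_ofReal_comp hφ']
    simp only [Complex.real_smul]
  rw [e1, e2, neg_one_sq, one_mul, eq_inv_mul_iff_mul_eq₀ hc2]
  linear_combination h1

theorem isBImage_mk {f g : ℝ →ₘ[volume] ℂ} {f₂ : ℝ → ℂ} (hf₂ : IsWeakDeriv 2 f f₂)
    (hg : (g : ℝ → ℂ) =ᵐ[volume] fun x => (c : ℂ) ^ 2 * f₂ x + 2 * f x + f (x + 1) + f (x + -1)) :
    IsBImage c f g := by
  have hm := hf₂.2.1.aestronglyMeasurable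
  refine ⟨AEEqFun.mk f₂ hm, hf₂.congr (ae_eq_refl _) (AEEqFun.coeFn_mk f₂ hm).symm, ?_⟩
  apply AEEqFun.ext
  filter_upwards [hg, AEEqFun.coeFn_mk f₂ hm, shift_coe 1 f, shift_coe (-1) f,
    AEEqFun.coeFn_add (((c : ℂ) ^ 2) • AEEqFun.mk f₂ hm + (2 : ℂ) • f + shift 1 f) (shift (-1) f),
    AEEqFun.coeFn_add (((c : ℂ) ^ 2) • AEEqFun.mk f₂ hm + (2 : ℂ) • f) (shift 1 f),
    AEEqFun.coeFn_add (((c : ℂ) ^ 2) • AEEqFun.mk f₂ hm) ((2 : ℂ) • f),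
    AEEqFun.coeFn_smul ((c : ℂ) ^ 2) (AEEqFun.mk f₂ hm), AEEqFun.coeFn_smul (2 : ℂ) f]
    with x h1 h2 h3 h4 h5 h6 h7 h8 h9
  rw [h1, h5, Pi.add_apply, h6, Pi.add_apply, h7, Pi.add_apply, h8, h9, h3, h4, Pi.smul_apply,
    Pi.smul_apply, h2, smul_eq_mul, smul_eq_mul]

theorem IsBImage.exists_ae_eq {f g : ℝ →ₘ[volume] ℂ} (h : IsBImage c f g) :
    ∃ f₂ : ℝ → ℂ, IsWeakDeriv 2 f f₂ ∧
      (g : ℝ → ℂ) =ᵐ[volume] fun x => (c : ℂ) ^ 2 * f₂ x + 2 * f x + f (x + 1) + f (x + -1) := by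
  obtain ⟨f₂, hf₂, rfl⟩ := h
  refine ⟨f₂, hf₂, ?_⟩
  filter_upwards [shift_coe 1 f, shift_coe (-1) f,
    AEEqFun.coeFn_add (((c : ℂ) ^ 2) • f₂ + (2 : ℂ) • f + shift 1 f) (shift (-1) f),
    AEEqFun.coeFn_add (((c : ℂ) ^ 2) • f₂ + (2 : ℂ) • f) (shift 1 f),
    AEEqFun.coeFn_add (((c : ℂ) ^ 2) • f₂) ((2 : ℂ) • f),
    AEEqFun.coeFn_smul ((c : ℂ) ^ 2) f₂, AEEqFun.coeFn_smul (2 : ℂ) f]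
    with x h3 h4 h5 h6 h7 h8 h9
  rw [h5, Pi.add_apply, h6, Pi.add_apply, h7, Pi.add_apply, h8, h9, h3, h4, Pi.smul_apply,
    Pi.smul_apply, smul_eq_mul, smul_eq_mul]

theorem IsBImage.integral_opB {f g : ℝ →ₘ[volume] ℂ} (h : IsBImage c f g) (hf : ExpBdd q M f)
    {φ : ℝ → ℂ} (hφ : ContDiff ℝ ∞ φ) (hs : HasCompactSupport φ) :
    ∫ x, opB c φ x * f x = ∫ x, φ x * g x := by
  obtain ⟨f₂, hf₂, hg⟩ := h.exists_ae_eq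
  rw [integral_opB_mul c hφ hs hf.locallyIntegrable, integral_mul_comp_add,
    integral_mul_comp_add, neg_neg, hf₂.integral_deriv_deriv_mul hφ hs]
  have i0 := (integrable_continuous_mul hf₂.2.1 hφ.continuous hs).const_mul ((c : ℂ) ^ 2)
  have i1 := (integrable_continuous_mul hf.locallyIntegrable hφ.continuous hs).const_mul 2
  have i2 := integrable_continuous_mul (hf.comp_add_right (-1)).locallyIntegrable hφ.continuous hs
  have i3 := integrable_continuous_mul (hf.comp_add_right 1).locallyIntegrable hφ.continuous hs
  have i01 : Integrable fun x => (c : ℂ) ^ 2 * (φ x * f₂ x) + 2 * (φ x * f x) := i0.add i1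
  have i012 : Integrable fun x => (c : ℂ) ^ 2 * (φ x * f₂ x) + 2 * (φ x * f x) +
    φ x * f (x + -1) := i01.add i2
  rw [← integral_const_mul, ← integral_const_mul, ← integral_add i0 i1, ← integral_add i01 i2,
    ← integral_add i012 i3]
  refine integral_congr_ae ?_
  filter_upwards [hg] with x hx
  rw [hx]
  ring

theorem shift_add (d : ℝ) (f g : ℝ →ₘ[volume] ℂ) : shift d (f + g) = shift d f + shift d g :=
  AEEqFun.induction_on₂ f g fun _ _ _ _ => rfl

theorem shift_smul (d : ℝ) (a : ℂ) (f : ℝ →ₘ[volume] ℂ) : shift d (a • f) = a • shift d f :=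
  AEEqFun.induction_on f fun _ _ => rfl

theorem IsBImage.add {f g f' g' : ℝ →ₘ[volume] ℂ} (h : IsBImage c f g) (h' : IsBImage c f' g') :
    IsBImage c (f + f') (g + g') := by
  obtain ⟨f₂, hf₂, rfl⟩ := h
  obtain ⟨f₂', hf₂', rfl⟩ := h'
  refine ⟨f₂ + f₂', (hf₂.add hf₂').congr (AEEqFun.coeFn_add f f').symm
    (AEEqFun.coeFn_add f₂ f₂').symm, ?_⟩
  rw [shift_add, shift_add, smul_add, smul_add]
  abel

theorem IsBImage.smul {f g : ℝ →ₘ[volume] ℂ} (h : IsBImage c f g) (a : ℂ) :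
    IsBImage c (a • f) (a • g) := by
  obtain ⟨f₂, hf₂, rfl⟩ := h
  refine ⟨a • f₂, (hf₂.const_smul a).congr (AEEqFun.coeFn_smul a f).symm
    (AEEqFun.coeFn_smul a f₂).symm, ?_⟩
  rw [shift_smul, shift_smul, smul_add, smul_add, smul_add, smul_comm a, smul_comm a (2 : ℂ)]

theorem IsBImage.unique {f g g' : ℝ →ₘ[volume] ℂ} (h : IsBImage c f g) (h' : IsBImage c f g') :
    g = g' := by
  obtain ⟨f₂, hf₂, rfl⟩ := h
  obtain ⟨k₂, hk₂, rfl⟩ := h'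
  rw [AEEqFun.ext (hf₂.unique hk₂)]

/-! ### Boundedness of `B_c` -/

theorem exists_isBImage (hc' : c ^ 2 ≤ 25 / 24) (hq : |q| ≤ 1) (f : WInf q 2) :
    ∃ g : LInf q, IsBImage c f g ∧ ‖g‖ ≤ 20 * ‖f‖ := by
  obtain ⟨f₂, hf₂, hb⟩ := exists_isWeakDeriv_two hq f
  have hf := expBdd_coe f
  have hn := norm_nonneg f
  have hG := ((((hb.const_smul ((c : ℂ) ^ 2)).add (hf.const_smul (2 : ℂ))).add
    (hf.comp_add_right 1)).add (hf.comp_add_right (-1)))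
  have hle : ‖(c : ℂ) ^ 2‖ * (4 * ‖f‖) + ‖(2 : ℂ)‖ * ‖f‖ + Real.exp (q * 1) * ‖f‖ +
      Real.exp (q * -1) * ‖f‖ ≤ 20 * ‖f‖ := by
    have e1 : Real.exp (q * 1) ≤ 3 := exp_le_three (by linarith [(abs_le.1 hq).2])
    have e2 : Real.exp (q * -1) ≤ 3 := exp_le_three (by linarith [(abs_le.1 hq).1])
    have e3 : ‖(c : ℂ) ^ 2‖ ≤ 25 / 24 := by
      rw [norm_pow, Complex.norm_real, Real.norm_eq_abs, sq_abs]
      exact hc'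
    have e4 : ‖(2 : ℂ)‖ = 2 := by simp
    rw [e4]
    nlinarith [mul_le_mul_of_nonneg_right e1 hn, mul_le_mul_of_nonneg_right e2 hn,
      mul_le_mul_of_nonneg_right e3 hn]
  have hG' := (hG.mono hle).congr (AEEqFun.coeFn_mk _ hG.1).symm
  refine ⟨⟨AEEqFun.mk _ hG.1, mem_LInf hG'⟩, isBImage_mk hf₂ ?_,
    norm_LInf_le (by positivity) _ hG'⟩
  filter_upwards [AEEqFun.coeFn_mk _ hG.1] with x hx
  rw [hx]
  simp

/-! ### Solvability -/

theorem kerBdd_green (hc : 1 ≤ c) (hc' : c ^ 2 ≤ 25 / 24) (hq : |q| ≤ 1 / 8) (h0 : q ≠ 0) :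
    KerBdd q |q| 41000 (green c q) :=
  ⟨(continuous_green hc (by linarith) h0).measurable, norm_green_le_exp hc hc' hq h0⟩

/-- The solution of `B_c f = g` in `W_q^{2,∞}`. -/
theorem exists_solution (hc : 1 ≤ c) (hc' : c ^ 2 ≤ 25 / 24) (hq : |q| ≤ 1 / 8) (h0 : q ≠ 0)
    (g : LInf q) : ∃ f : WInf q 2, IsBImage c f g ∧
      ((f : ℝ →ₘ[volume] ℂ) : ℝ → ℂ) =ᵐ[volume] convK (green c q) g ∧
      ‖f‖ ≤ 84132000 / |q| * ‖g‖ := by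
  have hq1 : |q| ≤ 1 := by linarith
  have hqp : 0 < |q| := abs_pos.2 h0
  have hK := kerBdd_green hc hc' hq h0
  have hg := expBdd_coe g
  have hn := norm_nonneg g
  have hF := hK.expBdd_convK (by norm_num) hqp hg
  set M₀ := 41000 * ‖g‖ * (2 / |q|) with hM₀
  have hM₀0 : 0 ≤ M₀ := by positivity
  have hgM : ‖g‖ ≤ M₀ := by
    have : 1 ≤ 2 / |q| := by rw [le_div_iff₀ hqp]; linarith
    nlinarith
  set f : ℝ →ₘ[volume] ℂ := AEEqFun.mk _ hF.1 with hf
  have hfF : (f : ℝ → ℂ) =ᵐ[volume] convK (green c q) g := AEEqFun.coeFn_mk _ hF.1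
  have hfb : ExpBdd q M₀ f := hF.congr hfF.symm
  have hweak : ∀ φ : ℝ → ℂ, ContDiff ℝ ∞ φ → HasCompactSupport φ →
      ∫ x, opB c φ x * f x = ∫ x, φ x * g.1 x := fun φ hφ hs => by
    have h1 := hK.integral_mul_convK (by norm_num) hqp hg (continuous_opB c hφ)
      (hasCompactSupport_opB c hs)
    rw [adjK_green_opB hc (by linarith) h0 hφ hs] at h1
    rw [← h1]
    refine integral_congr_ae ?_
    filter_upwards [hfF] with x hx
    rw [hx]
  have hd₂ := isWeakDeriv_two_of_integral_opB (by linarith : c ≠ 0) hfb hg hweak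
  have hb₂ := (((hg.add (hfb.const_smul (-2 : ℂ))).add
    ((hfb.comp_add_right 1).const_smul (-1))).add
      ((hfb.comp_add_right (-1)).const_smul (-1))).const_smul ((c : ℂ) ^ 2)⁻¹
  -- The count is `1 + 2 + 3 + 3`: one for `g`, two for `2f`, and at most three for each shift, as
  -- `e^{|q|} ≤ 3`.
  have hb₂' := hb₂.mono (N := 9 * M₀) (by
    have e1 : Real.exp (q * 1) ≤ 3 := exp_le_three (by linarith [(abs_le.1 hq1).2])
    have e2 : Real.exp (q * -1) ≤ 3 := exp_le_three (by linarith [(abs_le.1 hq1).1])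
    have e3 : ‖((c : ℂ) ^ 2)⁻¹‖ ≤ 1 := by
      rw [norm_inv, norm_pow, Complex.norm_real, Real.norm_eq_abs, sq_abs]
      exact inv_le_one_of_one_le₀ (by nlinarith)
    have e4 : ‖(-2 : ℂ)‖ = 2 := by simp
    have e5 : ‖(-1 : ℂ)‖ = 1 := by simp
    rw [e4, e5]
    refine (mul_le_of_le_one_left (by positivity) e3).trans ?_
    nlinarith [mul_le_mul_of_nonneg_right e1 hM₀0, mul_le_mul_of_nonneg_right e2 hM₀0])
  obtain ⟨f₁, hd₁, hb₁⟩ := hd₂.exists_one hq1 hfb hb₂' hM₀0 (by positivity)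
  have hmem := mem_WInf_two hfb hb₁ hb₂' hM₀0 (by positivity) (by positivity) hq1 hd₁ hd₂
  refine ⟨⟨f, hmem⟩, isBImage_mk hd₂ ?_, hfF, ?_⟩
  · refine Eventually.of_forall fun x => ?_
    have hc2 : (c : ℂ) ^ 2 ≠ 0 := pow_ne_zero 2 (Complex.ofReal_ne_zero.2 (by linarith))
    simp only [Pi.smul_apply, Pi.add_apply, smul_eq_mul]
    rw [mul_inv_cancel_left₀ hc2]
    ring
  -- With `M₂ = 9M₀` and `M₁ = (4 + 18 · 9)M₀ = 166M₀`, the norm is at most `3(9 + 332 + 1)M₀`; here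
  -- `M₀ = 82000‖g‖/|q|`.
  · refine (norm_WInf_two_le ⟨f, hmem⟩ hfb hb₁ hb₂' hM₀0 (by positivity) (by positivity) hq1
      hd₁ hd₂).trans_eq ?_
    rw [hM₀]
    ring

end AdvanceDelay
end

noncomputable section

namespace AdvanceDelay

open Filter Topology

/-! ### Injectivity -/

variable {c q M : ℝ}

/-- The operator `adjK` commutes with derivatives and translations, hence with `B_c`, so the left
inverse is also a right inverse on test functions. -/
theorem opB_adjK_green (hc : 1 ≤ c) (hc' : c ^ 2 ≤ 25 / 24) (hq : |q| ≤ 1 / 8) (h0 : q ≠ 0)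
    {φ : ℝ → ℂ} (hφ : ContDiff ℝ ∞ φ) (hs : HasCompactSupport φ) :
    opB c (adjK (green c q) φ) = φ := by
  have hK := kerBdd_green hc hc' hq h0
  nth_rewrite 2 [← adjK_green_opB hc (by linarith) h0 hφ hs]
  ext s
  have hG := continuous_green hc (by linarith : |q| ≤ 1 / 4) h0
  have hw : LocallyIntegrable fun x => green c q (x - s) :=
    (hG.comp (continuous_id.sub continuous_const)).locallyIntegrable
  have e : ∀ ψ : ℝ → ℂ, adjK (green c q) ψ s = ∫ x, ψ x * green c q (x - s) := fun ψ => by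
    simp only [adjK, mul_comm]
  rw [opB, hK.deriv_adjK hφ hs, hK.deriv_adjK (contDiff_infty_deriv hφ) hs.deriv,
    ← adjK_comp_add, ← adjK_comp_add, e, e, e, e, e, integral_opB_mul c hφ hs hw]

/-! ### Cutoffs and test functions without compact support -/

theorem deriv_deriv_cutoff_mul {χ ψ : ℝ → ℂ} (hχ : ContDiff ℝ ∞ χ) (hψ : ContDiff ℝ ∞ ψ)
    (a : ℝ) : deriv (deriv fun x => χ (a * x) * ψ x) = fun x =>
      (a : ℂ) ^ 2 * deriv (deriv χ) (a * x) * ψ x + 2 * a * deriv χ (a * x) * deriv ψ x +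
        χ (a * x) * deriv (deriv ψ) x := by
  have hχ' := contDiff_infty_deriv hχ
  have hψ' := contDiff_infty_deriv hψ
  have hd : ∀ {f : ℝ → ℂ}, ContDiff ℝ ∞ f → ∀ x, HasDerivAt f (deriv f x) x := fun hf x =>
    (hf.differentiable (by simp) x).hasDerivAt
  have hda : ∀ {f : ℝ → ℂ}, ContDiff ℝ ∞ f → ∀ x : ℝ,
      HasDerivAt (fun x => f (a * x)) (a * deriv f (a * x)) x := fun hf x => by
    have h1 : HasDerivAt (fun x : ℝ => a * x) (a * 1) x := (hasDerivAt_id x).const_mul a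
    refine ((hd hf (a * x)).scomp x h1).congr_deriv ?_
    rw [mul_one, Complex.real_smul]
  have e1 : deriv (fun x => χ (a * x) * ψ x) = fun x =>
      a * deriv χ (a * x) * ψ x + χ (a * x) * deriv ψ x := by
    ext x
    exact ((hda hχ x).mul (hd hψ x)).deriv
  rw [e1]
  ext x
  refine (((((hda hχ' x).const_mul (a : ℂ)).mul (hd hψ x)).add
    ((hda hχ x).mul (hd hψ' x))).congr_deriv ?_).deriv
  ring

theorem exists_cutoff : ∃ χ : ℝ → ℂ, ContDiff ℝ ∞ χ ∧ HasCompactSupport χ ∧ χ 0 = 1 := by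
  let β : ContDiffBump (0 : ℝ) := ⟨1, 2, one_pos, one_lt_two⟩
  refine ⟨fun x => (β x : ℂ), contDiff_ofReal_comp β.contDiff,
    hasCompactSupport_ofReal_comp β.hasCompactSupport, ?_⟩
  have : β 0 = 1 := β.one_of_mem_closedBall (by simp [β])
  simp [this]

theorem exists_norm_le {ψ : ℝ → ℂ} (hψ : Continuous ψ) (hs : HasCompactSupport ψ) :
    ∃ C, 0 ≤ C ∧ ∀ x, ‖ψ x‖ ≤ C := by
  obtain ⟨C, hC⟩ := hψ.bounded_above_of_compact_support hs
  exact ⟨C, (norm_nonneg _).trans (hC 0), hC⟩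

theorem norm_opB_cutoff_le {χ ψ : ℝ → ℂ} (hχ : ContDiff ℝ ∞ χ) (hψ : ContDiff ℝ ∞ ψ) {a C : ℝ}
    (ha : |a| ≤ 1) (h0 : ∀ x, ‖χ x‖ ≤ C) (h1 : ∀ x, ‖deriv χ x‖ ≤ C)
    (h2 : ∀ x, ‖deriv (deriv χ) x‖ ≤ C) (c x : ℝ) :
    ‖opB c (fun x => χ (a * x) * ψ x) x‖ ≤
      C * (c ^ 2 * (‖ψ x‖ + 2 * ‖deriv ψ x‖ + ‖deriv (deriv ψ) x‖) + 2 * ‖ψ x‖ + ‖ψ (x + 1)‖ +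
        ‖ψ (x + -1)‖) := by
  have hC : 0 ≤ C := (norm_nonneg _).trans (h0 0)
  have na : ‖(a : ℂ)‖ ≤ 1 := by simpa using ha
  have na2 : ‖(a : ℂ) ^ 2‖ ≤ 1 := by
    rw [norm_pow]; exact pow_le_one₀ (norm_nonneg _) na
  have nc : ‖(c : ℂ) ^ 2‖ = c ^ 2 := by
    rw [norm_pow, Complex.norm_real, Real.norm_eq_abs, sq_abs]
  rw [opB, deriv_deriv_cutoff_mul hχ hψ]
  refine (norm_add₄_le).trans ?_
  have b1 : ‖(c : ℂ) ^ 2 * ((a : ℂ) ^ 2 * deriv (deriv χ) (a * x) * ψ x +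
      2 * a * deriv χ (a * x) * deriv ψ x + χ (a * x) * deriv (deriv ψ) x)‖ ≤
      c ^ 2 * (1 * C * ‖ψ x‖ + 2 * 1 * C * ‖deriv ψ x‖ + C * ‖deriv (deriv ψ) x‖) := by
    rw [norm_mul, nc]
    gcongr
    refine (norm_add₃_le).trans ?_
    simp only [norm_mul, Complex.norm_ofNat]
    gcongr
    · exact h2 _
    · exact h1 _
    · exact h0 _
  have b2 : ∀ y, ‖χ (a * y) * ψ y‖ ≤ C * ‖ψ y‖ := fun y => by
    rw [norm_mul]
    gcongr
    exact h0 _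
  have b3 : ‖2 * (χ (a * x) * ψ x)‖ ≤ 2 * (C * ‖ψ x‖) := by
    rw [norm_mul, Complex.norm_ofNat]
    gcongr
    exact b2 x
  linarith [b2 (x + 1), b2 (x + -1)]

theorem tendsto_opB_cutoff {χ ψ : ℝ → ℂ} (hχ : ContDiff ℝ ∞ χ) (hψ : ContDiff ℝ ∞ ψ)
    (h1 : χ 0 = 1) (c x : ℝ) {a : ℕ → ℝ} (ha : Tendsto a atTop (𝓝 0)) :
    Tendsto (fun n => opB c (fun x => χ (a n * x) * ψ x) x) atTop (𝓝 (opB c ψ x)) := by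
  have hχ' := contDiff_infty_deriv hχ
  have hχ'' := contDiff_infty_deriv hχ'
  have e : (fun n => opB c (fun x => χ (a n * x) * ψ x) x) =
      (fun a : ℝ => (c : ℂ) ^ 2 * ((a : ℂ) ^ 2 * deriv (deriv χ) (a * x) * ψ x +
        2 * a * deriv χ (a * x) * deriv ψ x + χ (a * x) * deriv (deriv ψ) x) +
        2 * (χ (a * x) * ψ x) + χ (a * (x + 1)) * ψ (x + 1) +
        χ (a * (x + -1)) * ψ (x + -1)) ∘ a := by
    ext n
    simp only [opB, deriv_deriv_cutoff_mul hχ hψ, Function.comp]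
  rw [e]
  refine Tendsto.comp (y := 𝓝 0) ?_ ha
  have c0 := hχ.continuous
  have c1 := hχ'.continuous
  have c2 := hχ''.continuous
  refine Continuous.tendsto' (by fun_prop) 0 _ ?_
  simp [opB, h1]

/-- Formally, `∫ φ f = ∫ (B_c ψ) f = 0` for `ψ = adjK G φ`. As `ψ` need not have compact support, it
is replaced by `χ(x/(n+1)) ψ`. Dominated convergence applies because `ψ`, its first two derivatives
and its shifts are all integrable against `f`. -/
theorem eq_zero_of_integral_opB_eq_zero (hc : 1 ≤ c) (hc' : c ^ 2 ≤ 25 / 24) (hq : |q| ≤ 1 / 8)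
    (h0 : q ≠ 0) {f : ℝ → ℂ} (hf : ExpBdd q M f)
    (h : ∀ φ : ℝ → ℂ, ContDiff ℝ ∞ φ → HasCompactSupport φ → ∫ x, opB c φ x * f x = 0) :
    f =ᵐ[volume] 0 := by
  have hqp : 0 < |q| := abs_pos.2 h0
  have hK := kerBdd_green hc hc' hq h0
  have key : ∀ φ : ℝ → ℂ, ContDiff ℝ ∞ φ → HasCompactSupport φ → ∫ x, φ x * f x = 0 :=
    fun φ hφ hs => by
      have hφ' := contDiff_infty_deriv hφ
      have hφ'' := contDiff_infty_deriv hφ'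
      set ψ := adjK (green c q) φ with hψd
      have hψ : ContDiff ℝ ∞ ψ := hK.contDiff_adjK hφ hs
      have d1 : deriv ψ = adjK (green c q) (deriv φ) := hK.deriv_adjK hφ hs
      have d2 : deriv (deriv ψ) = adjK (green c q) (deriv (deriv φ)) := by
        rw [d1, hK.deriv_adjK hφ' hs.deriv]
      have int : ∀ {η : ℝ → ℂ}, Continuous η → HasCompactSupport η →
          Integrable fun x => ‖adjK (green c q) η x‖ * ‖f x‖ := fun hη hηs => by
        simpa only [norm_mul] using
          (hK.integrable_adjK_mul (by norm_num) hqp hf hη hηs).norm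
      have i0 : Integrable fun x => ‖ψ x‖ * ‖f x‖ := int hφ.continuous hs
      have i1 : Integrable fun x => ‖deriv ψ x‖ * ‖f x‖ := by
        rw [d1]; exact int hφ'.continuous hs.deriv
      have i2 : Integrable fun x => ‖deriv (deriv ψ) x‖ * ‖f x‖ := by
        rw [d2]; exact int hφ''.continuous hs.deriv.deriv
      have i3 : ∀ d : ℝ, Integrable fun x => ‖ψ (x + d)‖ * ‖f x‖ := fun d => by
        simp only [hψd, ← adjK_comp_add]
        exact int (continuous_comp_add hφ.continuous d) (hasCompactSupport_comp_add hs d)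
      obtain ⟨χ, hχ, hχs, hχ1⟩ := exists_cutoff
      have hχ' := contDiff_infty_deriv hχ
      have hχ'' := contDiff_infty_deriv hχ'
      obtain ⟨C0, p0, b0⟩ := exists_norm_le hχ.continuous hχs
      obtain ⟨C1, p1, b1⟩ := exists_norm_le hχ'.continuous hχs.deriv
      obtain ⟨C2, p2, b2⟩ := exists_norm_le hχ''.continuous hχs.deriv.deriv
      set C := C0 + C1 + C2
      set a : ℕ → ℝ := fun n => 1 / ((n : ℝ) + 1) with ha
      have ha0 : ∀ n, a n ≠ 0 := fun n => by positivity
      have ha1 : ∀ n, |a n| ≤ 1 := fun n => by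
        have : 0 < (n : ℝ) + 1 := by positivity
        rw [abs_of_pos (by positivity), ha]
        dsimp only
        rw [div_le_one this]
        linarith [(Nat.cast_nonneg n : (0 : ℝ) ≤ n)]
      have hat : Tendsto a atTop (𝓝 0) := tendsto_one_div_add_atTop_nhds_zero_nat
      have hcont : ∀ n, ContDiff ℝ ∞ fun x => χ (a n * x) * ψ x := fun n =>
        (hχ.comp (contDiff_const.mul contDiff_id)).mul hψ
      have hsupp : ∀ n, HasCompactSupport fun x => χ (a n * x) * ψ x := fun n =>
        (hχs.comp_homeomorph (Homeomorph.mulLeft₀ (a n) (ha0 n))).mul_right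
      have hlim := tendsto_integral_of_dominated_convergence
        (F := fun n x => opB c (fun x => χ (a n * x) * ψ x) x * f x)
        (f := fun x => opB c ψ x * f x) (μ := volume)
        (fun x => C * (c ^ 2 * (‖ψ x‖ * ‖f x‖ + 2 * (‖deriv ψ x‖ * ‖f x‖) +
          ‖deriv (deriv ψ) x‖ * ‖f x‖) + 2 * (‖ψ x‖ * ‖f x‖) + ‖ψ (x + 1)‖ * ‖f x‖ +
          ‖ψ (x + -1)‖ * ‖f x‖))
        (fun n => (continuous_opB c (hcont n)).aestronglyMeasurable.mul hf.1)
        ((((((((i0.add (i1.const_mul 2)).add i2).const_mul (c ^ 2)).add (i0.const_mul 2)).add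
          (i3 1)).add (i3 (-1))).const_mul C))
        (fun n => Eventually.of_forall fun x => by
          have := norm_opB_cutoff_le hχ hψ (ha1 n) (C := C)
            (fun x => (b0 x).trans (by simp only [C]; linarith))
            (fun x => (b1 x).trans (by simp only [C]; linarith))
            (fun x => (b2 x).trans (by simp only [C]; linarith)) c x
          rw [norm_mul]
          refine (mul_le_mul_of_nonneg_right this (norm_nonneg (f x))).trans_eq ?_
          ring)
        (Eventually.of_forall fun x => (tendsto_opB_cutoff hχ hψ hχ1 c x hat).mul_const (f x))
      simp only [h _ (hcont _) (hsupp _)] at hlim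
      rw [opB_adjK_green hc hc' hq h0 hφ hs] at hlim
      exact (tendsto_nhds_unique hlim tendsto_const_nhds)
  refine ae_eq_zero_of_integral_contDiff_smul_eq_zero hf.locallyIntegrable fun φ hφ hs => ?_
  have := key _ (contDiff_ofReal_comp hφ) (hasCompactSupport_ofReal_comp hs)
  simpa only [Complex.real_smul] using this

/-! ### The contour formula -/

/-- The values `a = 1` and `a = -1` serve the two Laplace transforms. The surplus decay `e^{-κs}`,
together with the decay of the kernel in `t`, gives absolute convergence of the double integral. -/
theorem integrable_kernelK_laplace {σ κ x a : ℝ} (hc : 1 ≤ c) (hσ : |σ| ≤ 1 / 4) (h0 : σ ≠ 0)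
    (hκ : 0 < κ) {h : ℝ → ℂ}
    (hm : AEStronglyMeasurable h (volume.restrict (Set.Ioi 0)))
    (hb : ∀ᵐ s ∂(volume.restrict (Set.Ioi (0 : ℝ))), ‖h s‖ ≤ M * Real.exp (a * s * σ - κ * s)) :
    Integrable (Function.uncurry fun (t s : ℝ) => kernelK c x (vline σ t) *
      (h s * Complex.exp (-((a * s : ℝ) * vline σ t))))
      ((volume : Measure ℝ).prod (volume.restrict (Set.Ioi 0))) := by
  have h1 : IntegrableOn (fun s : ℝ => M * Real.exp (-κ * s)) (Set.Ioi 0) :=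
    (integrableOn_exp_mul_Ioi (neg_neg_of_pos hκ) 0).const_mul M
  have h2 := (integrable_const_div_one_add_sq (400 / |σ| * Real.exp (x * σ))).mul_prod h1
  refine h2.mono' ?_ ?_
  · have hk : Continuous fun p : ℝ × ℝ => kernelK c x (vline σ p.1) :=
      (continuous_kernelK_vline hc hσ h0).comp (continuous_const.prodMk continuous_fst)
    have he : Continuous fun p : ℝ × ℝ => Complex.exp (-((a * p.2 : ℝ) * vline σ p.1)) := by
      have := continuous_vline σ
      fun_prop
    exact hk.aestronglyMeasurable.mul
      ((hm.comp_quasiMeasurePreserving Measure.quasiMeasurePreserving_snd).mul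
        he.aestronglyMeasurable)
  · filter_upwards [(Measure.quasiMeasurePreserving_snd (μ := (volume : Measure ℝ))).ae hb]
      with p hp
    simp only [Function.uncurry]
    rw [norm_mul, norm_mul, ← neg_mul, ← Complex.ofReal_neg, norm_exp_mul_vline]
    refine mul_le_mul (norm_kernelK_le hc hσ h0 x p.1) ?_ (by positivity) (by positivity)
    calc ‖h p.2‖ * Real.exp (-(a * p.2) * σ)
        ≤ M * Real.exp (a * p.2 * σ - κ * p.2) * Real.exp (-(a * p.2) * σ) := by gcongr
      _ = M * Real.exp (-κ * p.2) := by
        rw [mul_assoc, ← Real.exp_add]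
        ring_nf

theorem kernelK_mul_exp (c x y : ℝ) (z : ℂ) :
    kernelK c x z * Complex.exp (-((y : ℝ) * z)) = kernelK c (x - y) z := by
  rw [kernelK, kernelK, div_mul_eq_mul_div, ← Complex.exp_add]
  congr 2
  push_cast
  ring

theorem contourIntegral_kernelK_laplace {σ κ x a : ℝ} (hc : 1 ≤ c) (hσ : |σ| ≤ 1 / 4)
    (h0 : σ ≠ 0) (hκ : 0 < κ) {h : ℝ → ℂ}
    (hm : AEStronglyMeasurable h (volume.restrict (Set.Ioi 0)))
    (hb : ∀ᵐ s ∂(volume.restrict (Set.Ioi (0 : ℝ))), ‖h s‖ ≤ M * Real.exp (a * s * σ - κ * s)) :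
    contourIntegral σ (fun z => kernelK c x z *
      ∫ s in Set.Ioi (0 : ℝ), h s * Complex.exp (-((a * s : ℝ) * z))) =
      ∫ s in Set.Ioi (0 : ℝ), green c σ (x - a * s) * h s := by
  have hi := integrable_kernelK_laplace (x := x) hc hσ h0 hκ hm hb
  have hsw := integral_integral_swap hi
  simp only [integral_const_mul] at hsw
  rw [contourIntegral, integral_mul_const, hsw, ← integral_mul_const, ← integral_const_mul]
  refine integral_congr_ae (Eventually.of_forall fun s => ?_)
  dsimp only
  rw [green, contourIntegral, integral_mul_const]
  have e : ∀ t, kernelK c x (vline σ t) * (h s * Complex.exp (-((a * s : ℝ) * vline σ t))) =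
      kernelK c (x - a * s) (vline σ t) * h s := fun t => by
    rw [← kernelK_mul_exp]
    ring
  simp only [e, integral_mul_const]
  ring

end AdvanceDelay
end

noncomputable section

namespace AdvanceDelay

open Filter Topology

variable {c q M δ : ℝ}

/-! ### Absolute convergence and evaluation of the two contour integrals -/

theorem ExpBdd.laplacePlus_bound {g : ℝ → ℂ} (hg : ExpBdd q M g) (δ : ℝ) :
    ∀ᵐ s ∂(volume.restrict (Set.Ioi (0 : ℝ))),
      ‖g s‖ ≤ M * Real.exp (1 * s * (q + δ) - δ * s) := by
  filter_upwards [ae_restrict_of_ae hg.2] with s hs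
  refine hs.trans_eq ?_
  ring_nf

theorem ExpBdd.laplaceMinus_bound {g : ℝ → ℂ} (hg : ExpBdd q M g) (δ : ℝ) :
    ∀ᵐ s ∂(volume.restrict (Set.Ioi (0 : ℝ))),
      ‖g (-s)‖ ≤ M * Real.exp (-1 * s * (q - δ) - δ * s) := by
  have hneg := (Measure.measurePreserving_neg (volume : Measure ℝ)).quasiMeasurePreserving
  filter_upwards [ae_restrict_of_ae (hneg.ae hg.2)] with s hs
  refine hs.trans_eq ?_
  ring_nf

theorem ExpBdd.aestronglyMeasurable_comp_neg {g : ℝ → ℂ} (hg : ExpBdd q M g) :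
    AEStronglyMeasurable (fun s => g (-s)) volume :=
  hg.1.comp_quasiMeasurePreserving
    (Measure.measurePreserving_neg (volume : Measure ℝ)).quasiMeasurePreserving

theorem laplacePlus_eq (g : ℝ → ℂ) (z : ℂ) : laplacePlus g z =
    ∫ s in Set.Ioi (0 : ℝ), g s * Complex.exp (-((1 * s : ℝ) * z)) := by
  simp only [laplacePlus, one_mul]

theorem laplaceMinus_eq (g : ℝ → ℂ) (z : ℂ) : laplaceMinus g z =
    ∫ s in Set.Ioi (0 : ℝ), g (-s) * Complex.exp (-((-1 * s : ℝ) * z)) := by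
  simp only [laplaceMinus, neg_mul, one_mul, Complex.ofReal_neg, neg_neg]

theorem integrable_kernelK_laplacePlus (hc : 1 ≤ c) (hσ : |q + δ| ≤ 1 / 4) (h0 : q + δ ≠ 0)
    (hδ : 0 < δ) {g : ℝ → ℂ} (hg : ExpBdd q M g) (x : ℝ) :
    Integrable fun t : ℝ => kernelK c x (vline (q + δ) t) * laplacePlus g (vline (q + δ) t) := by
  have := (integrable_kernelK_laplace (x := x) hc hσ h0 hδ hg.1.restrict
    (hg.laplacePlus_bound δ)).integral_prod_left
  simpa only [Function.uncurry, integral_const_mul, laplacePlus_eq] using this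

theorem integrable_kernelK_laplaceMinus (hc : 1 ≤ c) (hσ : |q - δ| ≤ 1 / 4) (h0 : q - δ ≠ 0)
    (hδ : 0 < δ) {g : ℝ → ℂ} (hg : ExpBdd q M g) (x : ℝ) :
    Integrable fun t : ℝ => kernelK c x (vline (q - δ) t) * laplaceMinus g (vline (q - δ) t) := by
  have := (integrable_kernelK_laplace (x := x) hc hσ h0 hδ
    hg.aestronglyMeasurable_comp_neg.restrict (hg.laplaceMinus_bound δ)).integral_prod_left
  simpa only [Function.uncurry, integral_const_mul, laplaceMinus_eq] using this

/-- The contour formula for the convolution with the Green's function. -/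
theorem contourIntegral_add_contourIntegral (hc : 1 ≤ c) (hc' : c ^ 2 ≤ 25 / 24)
    (hq : |q| ≤ 1 / 8) (hδ : 0 < δ) (hδq : δ < |q|) {g : ℝ → ℂ} (hg : ExpBdd q M g) (x : ℝ) :
    contourIntegral (q + δ) (fun z => kernelK c x z * laplacePlus g z) +
      contourIntegral (q - δ) (fun z => kernelK c x z * laplaceMinus g z) =
    convK (green c q) g x := by
  have h0 : q ≠ 0 := abs_pos.1 (hδ.trans hδq)
  have hp : |q + δ| ≤ 1 / 4 := (abs_add_le _ _).trans (by rw [abs_of_pos hδ]; linarith)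
  have hm : |q - δ| ≤ 1 / 4 := (abs_sub _ _).trans (by rw [abs_of_pos hδ]; linarith)
  -- Since `δ < |q|`, both shifted contours lie on the same side of the imaginary axis as `q`, so
  -- they define the same Green's function.
  have key : q + δ ≠ 0 ∧ q - δ ≠ 0 ∧ (∀ y, green c (q + δ) y = green c q y) ∧
      ∀ y, green c (q - δ) y = green c q y := by
    rcases lt_or_gt_of_ne h0 with h | h
    · rw [abs_of_neg h] at hq hδq
      exact ⟨by linarith, by linarith,
        fun y => (green_eq_of_neg hc (by linarith) (by linarith) (by linarith) y).symm,
        fun y => green_eq_of_neg hc h (by linarith) (by linarith) y⟩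
    · rw [abs_of_pos h] at hq hδq
      exact ⟨by linarith, by linarith,
        fun y => (green_eq_of_pos hc h (by linarith) (by linarith) y).symm,
        fun y => green_eq_of_pos hc (by linarith) (by linarith) (by linarith) y⟩
  obtain ⟨hp0, hm0, gp, gm⟩ := key
  simp only [laplacePlus_eq, laplaceMinus_eq]
  rw [contourIntegral_kernelK_laplace hc hp hp0 hδ hg.1.restrict (hg.laplacePlus_bound δ),
    contourIntegral_kernelK_laplace hc hm hm0 hδ hg.aestronglyMeasurable_comp_neg.restrict
      (hg.laplaceMinus_bound δ)]
  simp only [gp, gm, one_mul, neg_mul]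
  -- Reflection turns the `laplaceMinus` term into the integral over `s ≤ 0`, which completes the
  -- convolution over the line.
  have e := integral_comp_neg_Ioi (0 : ℝ) fun s => green c q (x - s) * g s
  rw [neg_zero] at e
  have hi := (kerBdd_green hc hc' hq h0).integrable_conv (by norm_num) (abs_pos.2 h0) hg x
  rw [e, add_comm, intervalIntegral.integral_Iic_add_Ioi hi.integrableOn hi.integrableOn, convK]

/-! ### The isomorphism -/

/-- `B_c` as a linear map from `W_q^{2,∞}` to `L_q^∞`. -/
def linB (c q : ℝ) (hc' : c ^ 2 ≤ 25 / 24) (hq : |q| ≤ 1) : WInf q 2 →ₗ[ℂ] LInf q where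
  toFun f := (exists_isBImage hc' hq f).choose
  map_add' f g := Subtype.ext <| (exists_isBImage hc' hq (f + g)).choose_spec.1.unique <|
    (exists_isBImage hc' hq f).choose_spec.1.add (exists_isBImage hc' hq g).choose_spec.1
  map_smul' a f := Subtype.ext <| (exists_isBImage hc' hq (a • f)).choose_spec.1.unique <|
    (exists_isBImage hc' hq f).choose_spec.1.smul a

theorem linB_isBImage (hc' : c ^ 2 ≤ 25 / 24) (hq : |q| ≤ 1) (f : WInf q 2) :
    IsBImage c f (linB c q hc' hq f) :=
  (exists_isBImage hc' hq f).choose_spec.1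

theorem norm_linB_le (hc' : c ^ 2 ≤ 25 / 24) (hq : |q| ≤ 1) (f : WInf q 2) :
    ‖linB c q hc' hq f‖ ≤ 20 * ‖f‖ :=
  (exists_isBImage hc' hq f).choose_spec.2

theorem linB_injective (hc : 1 ≤ c) (hc' : c ^ 2 ≤ 25 / 24) (hq : |q| ≤ 1 / 8) (h0 : q ≠ 0)
    (hq1 : |q| ≤ 1) : Function.Injective (linB c q hc' hq1) := by
  rw [injective_iff_map_eq_zero]
  intro f hf
  have h1 := linB_isBImage hc' hq1 f
  rw [hf] at h1
  have hz : ((0 : LInf q).1 : ℝ → ℂ) =ᵐ[volume] 0 := AEEqFun.coeFn_zero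
  have h2 := eq_zero_of_integral_opB_eq_zero hc hc' hq h0 (expBdd_coe f) fun φ hφ hs => by
    rw [h1.integral_opB (expBdd_coe f) hφ hs]
    refine (integral_congr_ae ?_).trans (integral_zero ℝ ℂ)
    filter_upwards [hz] with x hx
    rw [hx, Pi.zero_apply, mul_zero]
  exact Subtype.ext (AEEqFun.ext (h2.trans hz.symm))

theorem exists_linB_eq (hc : 1 ≤ c) (hc' : c ^ 2 ≤ 25 / 24) (hq : |q| ≤ 1 / 8) (h0 : q ≠ 0)
    (hq1 : |q| ≤ 1) (g : LInf q) : ∃ f : WInf q 2, linB c q hc' hq1 f = g ∧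
      ((f : ℝ →ₘ[volume] ℂ) : ℝ → ℂ) =ᵐ[volume] convK (green c q) g ∧
      ‖f‖ ≤ 84132000 / |q| * ‖g‖ := by
  obtain ⟨f, hf, h⟩ := exists_solution hc hc' hq h0 g
  exact ⟨f, Subtype.ext ((linB_isBImage hc' hq1 f).unique hf), h⟩

/-- `B_c` is an isomorphism from `W_q^{2,∞}` onto `L_q^∞`, with inverse given by convolution with
the Green's function. -/
theorem exists_equiv (hc : 1 ≤ c) (hc' : c ^ 2 ≤ 25 / 24) (hq : |q| ≤ 1 / 8) (h0 : q ≠ 0) :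
    ∃ B : WInf q 2 ≃L[ℂ] LInf q, (∀ f : WInf q 2, IsBImage c f (B f)) ∧
      (∀ g : LInf q, ((B.symm g).1 : ℝ → ℂ) =ᵐ[volume] convK (green c q) g) ∧
      ‖(B.symm : LInf q →L[ℂ] WInf q 2)‖ ≤ 84132000 / |q| := by
  have hq1 : |q| ≤ 1 := by linarith
  have hex := exists_linB_eq hc hc' hq h0 hq1
  let e : WInf q 2 ≃ₗ[ℂ] LInf q := LinearEquiv.ofBijective (linB c q hc' hq1)
    ⟨linB_injective hc hc' hq h0 hq1, fun g => (hex g).imp fun _ h => h.1⟩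
  have hsymm : ∀ g : LInf q, ((e.symm g).1 : ℝ → ℂ) =ᵐ[volume] convK (green c q) g ∧
      ‖e.symm g‖ ≤ 84132000 / |q| * ‖g‖ := fun g => by
    obtain ⟨f, hf, h⟩ := hex g
    have : e.symm g = f := by
      rw [LinearEquiv.symm_apply_eq]
      exact hf.symm
    rw [this]
    exact h
  let B := e.toContinuousLinearEquivOfBounds 20 (84132000 / |q|) (norm_linB_le hc' hq1)
    fun g => (hsymm g).2
  exact ⟨B, linB_isBImage hc' hq1, fun g => (hsymm g).1,
    ContinuousLinearMap.opNorm_le_bound _ (by positivity) fun g => (hsymm g).2⟩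

theorem one_le_waveSpeed (ε : ℝ) : 1 ≤ waveSpeed ε := by
  rw [waveSpeed, Real.one_le_sqrt]
  linarith [sq_nonneg ε]

theorem waveSpeed_sq_le {ε : ℝ} (h0 : 0 < ε) (h1 : ε ≤ 1) : waveSpeed ε ^ 2 ≤ 25 / 24 := by
  rw [waveSpeed, Real.sq_sqrt (by positivity)]
  nlinarith

theorem rateB_pos {a qFP : ℝ} (ha : 0 < a) (hq : 0 < qFP) : 0 < rateB a qFP := by
  unfold rateB
  positivity

end AdvanceDelay
end

theorem proposition6p3 (a qFP εHWa : ℝ) (ha : 0 < a) (hqFP0 : 0 < qFP) (hqFP1 : qFP < 1)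
    (hεHWa : 0 < εHWa) :
    ∃ C : ℝ, 0 < C ∧ ∀ ε : ℝ, 0 < ε → ε < epsB a qFP εHWa →
      ∀ q δ : ℝ, (q = -(rateB a qFP * ε) ∨ q = rateB a qFP * ε) →
        δ = rateB a qFP * ε / 2 →
        -- `B` is an isomorphism from `W_q^{2,∞}` onto `L_q^∞`
        ∃ B : WInf q 2 ≃L[ℂ] LInf q,
          (∀ f : WInf q 2,
            IsBImage (waveSpeed ε) f (B f)) ∧
          -- the Laplace contour formula for its inverse, with absolutely convergent integrals
          (∀ (g : LInf q) (x : ℝ),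
            Integrable (fun t : ℝ =>
              kernelK (waveSpeed ε) x (vline (q + δ) t) *
                laplacePlus g.1 (vline (q + δ) t)) ∧
            Integrable (fun t : ℝ =>
              kernelK (waveSpeed ε) x (vline (q - δ) t) *
                laplaceMinus g.1 (vline (q - δ) t))) ∧
          (∀ g : LInf q, ∀ᵐ x : ℝ,
            (B.symm g).1 x =
              contourIntegral (q + δ) (fun z =>
                kernelK (waveSpeed ε) x z *
                  laplacePlus g.1 z) +
              contourIntegral (q - δ) (fun z =>
                kernelK (waveSpeed ε) x z *
                  laplaceMinus g.1 z)) ∧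
          -- the operator norm of the inverse is at most `C / ε`
          ‖(B.symm : LInf q →L[ℂ] WInf q 2)‖ ≤ C * ε⁻¹ := by
  have hb := rateB_pos ha hqFP0
  have hb8 : rateB a qFP ≤ 1 / 8 := min_le_left _ _
  -- The inverse has norm at most `84132000/|q|`, and `|q| = bε`.
  refine ⟨84132000 / rateB a qFP, by positivity, fun ε hε0 hε q δ hq hδ => ?_⟩
  have hε1 : ε < 1 := hε.trans_le ((min_le_right _ _).trans (min_le_right _ _))
  have hbε : 0 < rateB a qFP * ε := by positivity
  have habs : |q| = rateB a qFP * ε := by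
    rcases hq with rfl | rfl
    · rw [abs_neg, abs_of_pos hbε]
    · rw [abs_of_pos hbε]
  have hq8 : |q| ≤ 1 / 8 := by rw [habs]; nlinarith
  have hq0 : q ≠ 0 := abs_pos.1 (habs ▸ hbε)
  have hδ0 : 0 < δ := by rw [hδ]; positivity
  have hδq : δ < |q| := by rw [habs, hδ]; linarith
  have hc := one_le_waveSpeed ε
  have hc' := waveSpeed_sq_le hε0 hε1.le
  have hp : |q + δ| ≤ 1 / 4 := (abs_add_le _ _).trans (by rw [abs_of_pos hδ0]; linarith)
  have hm : |q - δ| ≤ 1 / 4 := (abs_sub _ _).trans (by rw [abs_of_pos hδ0]; linarith)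
  have hp0 : q + δ ≠ 0 := fun h => by
    rw [eq_neg_of_add_eq_zero_left h, abs_neg, abs_of_pos hδ0] at hδq
    exact lt_irrefl _ hδq
  have hm0 : q - δ ≠ 0 := fun h => by
    rw [sub_eq_zero.1 h, abs_of_pos hδ0] at hδq
    exact lt_irrefl _ hδq
  obtain ⟨B, hB, hsymm, hnorm⟩ := exists_equiv hc hc' hq8 hq0
  refine ⟨B, hB, fun g x => ⟨integrable_kernelK_laplacePlus hc hp hp0 hδ0 (expBdd_coe g) x,
    integrable_kernelK_laplaceMinus hc hm hm0 hδ0 (expBdd_coe g) x⟩, fun g => ?_, ?_⟩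
  · filter_upwards [hsymm g] with x hx
    rw [hx, contourIntegral_add_contourIntegral hc hc' hq8 hδ0 hδq (expBdd_coe g) x]
  · refine hnorm.trans_eq ?_
    rw [habs]
    field_simp
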